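/- Conventions. Let $U,V$ be subgroups of a finite group $G$ (or closed subgroups of a profinite group $G$). They are called \emph{Sylow-conjugate} in $G$ if, for every prime $p$, the $p$-Sylow subgroups of $U$ and of $V$ are conjugate in $G$; if $G$ is finite, they are called \emph{Gassmann equivalent} if $|C\cap U|=|C\cap V|$ for every conjugacy class $C$ of $G$. Two number fields $K,L$ are called Sylow-conjugate if, after embedding them in $\overline{\mathbb Q}$, the subgroups $\mathrm{Gal}(\overline{\mathbb Q}/K)$ and $\mathrm{Gal}(\overline{\mathbb Q}/L)$ are Sylow-conjugate in $\mathrm{Gal}(\overline{\mathbb Q}/\mathbb Q)$ (this does not depend on the embeddings), and arithmetically equivalent if their Dedekind zeta functions are equal. Let $F=\mathbb F_q$ be a finite field, let $d\ge 3$, and let $G=\mathrm{PSL}_d(q)$. Let $U\le G$ be the stabilizer of a $1$-dimensional subspace of $F^d$, and let $V\le G$ be the stabilizer of a hyperplane (a $(d-1)$-dimensional subspace) of $F^d$. Then: (1) $U$ and $V$ are maximal subgroups of $G$; they are Sylow-conjugate in $G$, not conjugate in $G$, but $\varphi(U)=V$ for some automorphism $\varphi$ of $G$ that is not inner; and they are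 Gassmann equivalent in $G$. (2) Let $M/\mathbb Q$ be a finite Galois extension with an isomorphism $\mathrm{Gal}(M/\mathbb Q)\cong G$, by which $U$ and $V$ are viewed as subgroups of $\mathrm{Gal}(M/\mathbb Q)$. Then the fixed fields $K=M^U$ and $L=M^V$ are number fields that are Sylow-conjugate and arithmetically equivalent, but not isomorphic. (3) There is a finite Galois extension $M/\mathbb Q$ with $\mathrm{Gal}(M/\mathbb Q)\cong \mathrm{PSL}_3(2)$, so that (2) yields such pairs of number fields. -/

import Mathlib

open scoped NumberField

/-- Two subgroups of `G` are conjugate in `G`. -/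
def SubgroupsConjugate {G : Type*} [Group G] (U V : Subgroup G) : Prop :=
  ∃ g : G, U.map (MulAut.conj g).toMonoidHom = V

/-- Sylow-conjugacy of subgroups of a finite group: for every prime `p`, the `p`-Sylow subgroups
of `U` and of `V` are conjugate in `G`. (Since all `p`-Sylow subgroups of a finite group are
conjugate in it, it does not matter which ones are taken.) -/
def SylowConjugate {G : Type*} [Group G] (U V : Subgroup G) : Prop :=
  ∀ p : ℕ, p.Prime → ∃ (P : Sylow p U) (Q : Sylow p V),
    SubgroupsConjugate ((P : Subgroup U).map U.subtype) ((Q : Subgroup V).map V.subtype)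

/-- Gassmann equivalence: `|C ∩ U| = |C ∩ V|` for every conjugacy class `C` of `G`. -/
def GassmannEquivalent {G : Type*} [Group G] (U V : Subgroup G) : Prop :=
  ∀ C : ConjClasses G, (C.carrier ∩ (U : Set G)).ncard = (C.carrier ∩ (V : Set G)).ncard

/-- `P` is a `p`-Sylow subgroup of the profinite group `H`: it is closed, pro-`p`, and of
(supernatural) index prime to `p`. The last two conditions are read off in the finite quotients
`H ⧸ N` by open normal subgroups `N`. -/
def IsProfiniteSylow (p : ℕ) {H : Type*} [Group H] [TopologicalSpace H] (P : Subgroup H) : Prop :=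
  IsClosed (P : Set H) ∧
    ∀ (N : Subgroup H) [N.Normal], IsOpen (N : Set H) →
      IsPGroup p (P.map (QuotientGroup.mk' N)) ∧ ¬ p ∣ (P.map (QuotientGroup.mk' N)).index

/-- Sylow-conjugacy of closed subgroups of a profinite group. (Again, all `p`-Sylow subgroups of
a profinite group are conjugate in it, so that the choice does not matter.) -/
def ProfiniteSylowConjugate {G : Type*} [Group G] [TopologicalSpace G] (U V : Subgroup G) : Prop :=
  ∀ p : ℕ, p.Prime → ∃ (P : Subgroup U) (Q : Subgroup V),
    IsProfiniteSylow p P ∧ IsProfiniteSylow p Q ∧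
      SubgroupsConjugate (P.map U.subtype) (Q.map V.subtype)

/-- Two number fields are Sylow-conjugate if their absolute Galois groups, as subgroups of
`Gal(ℚ̄/ℚ)`, are Sylow-conjugate. A number field is placed inside `ℚ̄` by an embedding; changing
the embedding replaces the absolute Galois group by a conjugate. -/
def NumberField.SylowConjugate (K L : Type*) [Field K] [NumberField K] [Field L]
    [NumberField L] : Prop :=
  ∀ (σ : K →ₐ[ℚ] AlgebraicClosure ℚ) (τ : L →ₐ[ℚ] AlgebraicClosure ℚ),
    ProfiniteSylowConjugate σ.fieldRange.fixingSubgroup τ.fieldRange.fixingSubgroup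

/-- Two number fields are arithmetically equivalent if their Dedekind zeta functions agree. -/
def NumberField.ArithmeticallyEquivalent (K L : Type*) [Field K] [NumberField K] [Field L]
    [NumberField L] : Prop :=
  NumberField.dedekindZeta K = NumberField.dedekindZeta L

/-- The stabilizer in `SL_d(F)` of a subspace of `F^d`. -/
def slStabilizer {d : ℕ} {F : Type*} [Field F] (W : Submodule F (Fin d → F)) :
    Subgroup (Matrix.SpecialLinearGroup (Fin d) F) where
  carrier := {A | W.map (Matrix.SpecialLinearGroup.toLin' A).toLinearMap = W}
  one_mem' := by
    simp only [Set.mem_ofPred_eq, map_one]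
    exact Submodule.map_id W
  mul_mem' := by
    intro A B hA hB
    simp only [Set.mem_ofPred_eq] at hA hB ⊢
    rw [map_mul]
    change W.map ((Matrix.SpecialLinearGroup.toLin' A).toLinearMap ∘ₗ
      (Matrix.SpecialLinearGroup.toLin' B).toLinearMap) = W
    rw [Submodule.map_comp, hB, hA]
  inv_mem' := by
    intro A hA
    simp only [Set.mem_ofPred_eq] at hA ⊢
    have h : (Matrix.SpecialLinearGroup.toLin' A⁻¹).toLinearMap ∘ₗ
        (Matrix.SpecialLinearGroup.toLin' A).toLinearMap = LinearMap.id := by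
      change (Matrix.SpecialLinearGroup.toLin' A⁻¹ *
        Matrix.SpecialLinearGroup.toLin' A).toLinearMap = LinearMap.id
      rw [← map_mul, inv_mul_cancel, map_one]
      rfl
    conv_lhs => rw [← hA]
    rw [← Submodule.map_comp, h, Submodule.map_id]

/-- The stabilizer in `PSL_d(F)` of a subspace of `F^d`. As the centre of `SL_d(F)` consists of
scalar matrices, which preserve every subspace, it is the image of the stabilizer in `SL_d(F)`. -/
def pslStabilizer {d : ℕ} {F : Type*} [Field F] (W : Submodule F (Fin d → F)) :
    Subgroup (Matrix.ProjectiveSpecialLinearGroup (Fin d) F) :=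
  (slStabilizer W).map (QuotientGroup.mk' (Subgroup.center _))

/-! A hyperplane is the set orthogonal to a vector `w`, and `A` fixes it exactly when `w` is an
eigenvector of `Aᵀ`. So inverse transpose exchanges line stabilizers and hyperplane stabilizers,
each kind being one conjugacy class of `PSL_d` because `SL_d` is transitive on lines. Maximality is
primitivity on projective space. For `d ≥ 3` the stabilizer of a hyperplane contains transvections
moving any given line, so the two kinds are not conjugate. Since `A` and `Aᵀ` have eigenspaces of
equal dimension, `A` fixes equally many lines and hyperplanes; counting incidences over a conjugacy
class gives Gassmann equivalence (`gassmannEquivalent_of_card_eq`). For Sylow-conjugacy, a `p`-group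
fixing a line also fixes a hyperplane: in characteristic `p` it has a non-zero fixed vector in the
dual space, otherwise a linear form can be averaged. As the stabilizers have equal order, this
suffices.

For the fixed fields, Sylow-conjugacy is pulled back along `Gal(ℚ̄/ℚ) → Gal(M/ℚ)`
(`SylowConjugate.comap`), and an isomorphism `K ≃ L` would extend to `M` and conjugate the groups.
For the zeta functions, let `Ω` be an algebraic closure of `𝔽_p`. The homomorphisms `𝓞 K → Ω` are
the `U`-orbits on the homomorphisms `𝓞 M → Ω`, so a Burnside count writes the number of those fixed
by a power of Frobenius as the average over `U` of a class function. Gassmann equivalence makes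
these numbers agree for `K` and `L`; they determine recursively the number of primes of each norm `p
^ n`, hence the number of ideals of each norm.

For `PSL_3(2)`, take the splitting field of `X ^ 7 - 7 X + 3`. Its group is transitive on the seven
roots, and a resolvent of degree 7 supplies a three-element set of roots with at most seven images.
An element of order 7 turns the roots into `ℤ/7` and the images into the translates of a set `D`.
Either `D` is a Fano line up to an affine map, or it is an arithmetic progression and the group
preserves a heptagon. Complex conjugation is an involution with two fixed points, which no symmetry
of a heptagon is; and a Singer cycle with an involution generates `SL_3(𝔽₂)`. -/

/-! ### The Fano plane and `SL_3(𝔽₂)` -/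

namespace Fano

/-- The non-zero vectors of `𝔽₂³`, listed as the powers of a root of `X ^ 3 + X + 1`. -/
def vec (i : ZMod 7) : Fin 3 → ZMod 2 :=
  ![![1, 0, 0], ![0, 1, 0], ![0, 0, 1], ![1, 1, 0], ![0, 1, 1], ![1, 1, 1], ![1, 0, 1]]
    (i : Fin 7)

/-- The standard difference set of order 2. -/
def diffSet : Finset (ZMod 7) := {0, 1, 3}

theorem vec_injective : Function.Injective vec := by
  decide

-- With `vec i` the `i`-th power of a root `α`, the relation `1 + α = α ^ 3` makes `{0, 1, 3}` a
-- line, and multiplication by `α` shifts exponents; so the lines are the translates of `diffSet`.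
set_option synthInstance.maxHeartbeats 200000 in
set_option synthInstance.maxSize 1000 in
theorem exists_line (i j k : ZMod 7) (hij : i ≠ j) (h : vec i + vec j = vec k) :
    ∃ m, i - m ∈ diffSet ∧ j - m ∈ diffSet ∧ k - m ∈ diffSet := by
  revert i j k
  decide

theorem vec_add (i j k m : ZMod 7) (hij : i ≠ j) (hik : i ≠ k) (hjk : j ≠ k)
    (hi : i - m ∈ diffSet) (hj : j - m ∈ diffSet) (hk : k - m ∈ diffSet) :
    vec i + vec j = vec k := by
  obtain ⟨i, rfl⟩ : ∃ i', i = i' + m := ⟨i - m, by ring⟩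
  obtain ⟨j, rfl⟩ : ∃ i', j = i' + m := ⟨j - m, by ring⟩
  obtain ⟨k, rfl⟩ : ∃ i', k = i' + m := ⟨k - m, by ring⟩
  simp only [add_sub_cancel_right] at hi hj hk
  have hij' : i ≠ j := fun h => hij (by rw [h])
  have hik' : i ≠ k := fun h => hik (by rw [h])
  have hjk' : j ≠ k := fun h => hjk (by rw [h])
  clear hij hik hjk
  revert m hij' hik' hjk'
  revert i j k
  decide

/-- The matrix sending the first three points to prescribed points. -/
def mat (t : ZMod 7 → ZMod 7) : Matrix (Fin 3) (Fin 3) (ZMod 2) :=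
  Matrix.of fun i j => vec (t ((j : ℕ) : ZMod 7)) i

/-- The map `t` permutes the translates of `D`. -/
def PermutesTranslates (D : Finset (ZMod 7)) (t : ZMod 7 → ZMod 7) : Prop :=
  ∀ i, ∃ j, ∀ x, x - i ∈ D ↔ t x - j ∈ D

/-- Preservation of the lines of the Fano plane. -/
def Collineation (t : ZMod 7 → ZMod 7) : Prop := PermutesTranslates diffSet t

theorem Collineation.vec_add {t : ZMod 7 → ZMod 7} (ht : Collineation t)
    (hinj : Function.Injective t) {i j k : ZMod 7} (hij : i ≠ j) (h : vec i + vec j = vec k) :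
    vec (t i) + vec (t j) = vec (t k) := by
  have hik : i ≠ k := by
    rintro rfl
    revert i j; decide
  have hjk : j ≠ k := by
    rintro rfl
    revert i j; decide
  obtain ⟨m, hi, hj, hk⟩ := exists_line i j k hij h
  obtain ⟨n, hn⟩ := ht m
  exact Fano.vec_add _ _ _ n (hinj.ne hij) (hinj.ne hik) (hinj.ne hjk) ((hn _).1 hi) ((hn _).1 hj)
    ((hn _).1 hk)

/-- The first three points form a basis, where the claim is the definition of `mat`; the other four
arise by adding two points of a line, which a collineation respects. -/
theorem Collineation.mat_mulVec {t : ZMod 7 → ZMod 7} (ht : Collineation t)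
    (hinj : Function.Injective t) (i : ZMod 7) : (mat t).mulVec (vec i) = vec (t i) := by
  have h0 : (mat t).mulVec (vec 0) = vec (t 0) := by
    ext k
    have : vec 0 = ![1, 0, 0] := rfl
    rw [this]; simp [mat, Matrix.mulVec, dotProduct, Fin.sum_univ_three]
  have h1 : (mat t).mulVec (vec 1) = vec (t 1) := by
    ext k
    have : vec 1 = ![0, 1, 0] := rfl
    rw [this]; simp [mat, Matrix.mulVec, dotProduct, Fin.sum_univ_three]
  have h2 : (mat t).mulVec (vec 2) = vec (t 2) := by
    ext k
    have : vec 2 = ![0, 0, 1] := rfl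
    rw [this]; simp [mat, Matrix.mulVec, dotProduct, Fin.sum_univ_three]
  have key : ∀ {i j : ZMod 7} (k : ZMod 7), (mat t).mulVec (vec i) = vec (t i) →
      (mat t).mulVec (vec j) = vec (t j) → i ≠ j → vec i + vec j = vec k →
      (mat t).mulVec (vec k) = vec (t k) := by
    intro i j k hi hj hij h
    rw [← h, Matrix.mulVec_add, hi, hj, ht.vec_add hinj hij h]
  have h3 := key 3 h0 h1 (by decide) (by decide)
  have h4 := key 4 h1 h2 (by decide) (by decide)
  have h5 := key 5 h0 h4 (by decide) (by decide)
  have h6 := key 6 h0 h2 (by decide) (by decide)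
  have : i = 0 ∨ i = 1 ∨ i = 2 ∨ i = 3 ∨ i = 4 ∨ i = 5 ∨ i = 6 := by revert i; decide
  rcases this with rfl | rfl | rfl | rfl | rfl | rfl | rfl <;> assumption

theorem Collineation.mat_comp {s t : ZMod 7 → ZMod 7} (hs : Collineation s)
    (hinj : Function.Injective s) : mat (s ∘ t) = mat s * mat t := by
  ext i j
  have := congrFun (hs.mat_mulVec hinj (t ((j : ℕ) : ZMod 7))) i
  simpa [mat, Matrix.mul_apply, Matrix.mulVec, dotProduct] using this.symm

theorem mat_id : mat id = 1 := by
  decide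

theorem mat_injective {s t : ZMod 7 → ZMod 7} (hs : Collineation s) (ht : Collineation t)
    (hsi : Function.Injective s) (hti : Function.Injective t) (h : mat s = mat t) : s = t := by
  funext i
  apply vec_injective
  rw [← hs.mat_mulVec hsi, h, ht.mat_mulVec hti]

/-- The representation on `𝔽₂³` of a group of collineations of the Fano plane. -/
def toSL {H : Type*} [Group H] (ρ : H →* Equiv.Perm (ZMod 7)) (hρ : ∀ h, Collineation (ρ h)) :
    H →* Matrix.SpecialLinearGroup (Fin 3) (ZMod 2) where
  toFun h := ⟨mat (ρ h), by
    have h1 : mat (ρ h) * mat (ρ h⁻¹) = 1 := by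
      rw [← (hρ h).mat_comp (ρ h).injective, ← mat_id]
      congr 1
      funext x
      simp
    have h2 := congrArg Matrix.det h1
    rw [Matrix.det_mul, Matrix.det_one] at h2
    -- In `𝔽₂` the only invertible value of the determinant is 1.
    generalize (mat (ρ h)).det = a at h2
    generalize (mat (ρ h⁻¹)).det = b at h2
    revert a b; decide⟩
  map_one' := by
    apply Subtype.ext
    simp only [map_one]
    exact mat_id
  map_mul' g h := by
    apply Subtype.ext
    simp only [map_mul]
    exact (hρ g).mat_comp (ρ g).injective

theorem toSL_injective {H : Type*} [Group H] (ρ : H →* Equiv.Perm (ZMod 7))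
    (hρ : ∀ h, Collineation (ρ h)) (hinj : Function.Injective ρ) :
    Function.Injective (toSL ρ hρ) := by
  intro g h hgh
  apply hinj
  apply Equiv.ext
  exact congrFun (mat_injective (hρ g) (hρ h) (ρ g).injective (ρ h).injective
    (congrArg Subtype.val hgh))

/-! ### Generation of `SL_3(𝔽₂)` by a Singer cycle and an involution -/

/-- Multiplication by a root of `X ^ 3 + X + 1`. -/
def singer : Matrix (Fin 3) (Fin 3) (ZMod 2) := !![0, 0, 1; 1, 0, 1; 0, 1, 0]

/-- A transvection with the first point as its centre. -/
def transv (a b : ZMod 2) : Matrix (Fin 3) (Fin 3) (ZMod 2) := !![1, a, b; 0, 1, 0; 0, 0, 1]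

theorem mat_add_one : mat (fun i => i + 1) = singer := by decide

-- Every involution of `SL_3(𝔽₂)` is a transvection. The Singer cycle, of order 7, permutes the
-- possible centres transitively, so conjugation by a power of it moves the centre to the first
-- point.
set_option maxRecDepth 10000 in
theorem exists_conj_transv (a b c d e f g h i : ZMod 2)
    (h2 : !![a, b, c; d, e, f; g, h, i] * !![a, b, c; d, e, f; g, h, i] = 1)
    (h1 : !![a, b, c; d, e, f; g, h, i] ≠ 1) :
    ∃ (n : Fin 7) (x y : ZMod 2), (x ≠ 0 ∨ y ≠ 0) ∧
      singer ^ (n : ℕ) * !![a, b, c; d, e, f; g, h, i] * singer ^ (7 - n : ℕ) = transv x y := by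
  revert a b c d e f g h i
  decide +kernel

open Matrix in
/-- Multiplication by a root of `X ^ 3 + X + 1`, as an element of `SL_3(𝔽₂)`. -/
def singerSL : SpecialLinearGroup (Fin 3) (ZMod 2) := ⟨singer, by decide⟩

open Matrix in
/-- The transvection `transv a b` as an element of `SL_3(𝔽₂)`. -/
def transvSL (a b : ZMod 2) : SpecialLinearGroup (Fin 3) (ZMod 2) :=
  ⟨transv a b, by revert a b; decide⟩

section
open Matrix

theorem sl_ext {n R : Type*} [Fintype n] [DecidableEq n] [CommRing R]
    {A B : SpecialLinearGroup n R} (h : (A : Matrix n n R) = B) : A = B :=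
  Subtype.ext h

theorem singerSL_pow_mul (n : Fin 7) (A : SpecialLinearGroup (Fin 3) (ZMod 2)) (x y : ZMod 2)
    (h : singer ^ (n : ℕ) * A.1 * singer ^ (7 - n : ℕ) = transv x y) :
    singerSL ^ (n : ℕ) * A * singerSL ^ (7 - n : ℕ) = transvSL x y := by
  apply sl_ext
  exact h

/-- For involutions the square of a product is a commutator. Commutators of a transvection with
suitable Singer conjugates of itself run cyclically through the three non-trivial transvections with
the first point as centre. -/
theorem transvSL_mem {I : Subgroup (SpecialLinearGroup (Fin 3) (ZMod 2))} (hA : singerSL ∈ I)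
    {x y : ZMod 2} (hxy : x ≠ 0 ∨ y ≠ 0) (h : transvSL x y ∈ I) (a b : ZMod 2) :
    transvSL a b ∈ I := by
  have step : ∀ (m : ℕ) (x y x' y' : ZMod 2),
      (singer ^ (7 - m) * transv x y * singer ^ m * transv x y) ^ 2 = transv x' y' →
      transvSL x y ∈ I → transvSL x' y' ∈ I := by
    intro m x y x' y' h hT
    have : (singerSL ^ (7 - m) * transvSL x y * singerSL ^ m * transvSL x y) ^ 2 =
        transvSL x' y' := by
      apply sl_ext
      exact h
    rw [← this]
    exact I.pow_mem (I.mul_mem (I.mul_mem (I.mul_mem (I.pow_mem hA _) hT) (I.pow_mem hA _)) hT) _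
  have h1 : transvSL 0 1 ∈ I → transvSL 1 0 ∈ I := step 1 _ _ _ _ (by decide)
  have h2 : transvSL 1 0 ∈ I → transvSL 1 1 ∈ I := step 2 _ _ _ _ (by decide)
  have h3 : transvSL 1 1 ∈ I → transvSL 0 1 ∈ I := step 4 _ _ _ _ (by decide)
  have h0 : transvSL 0 0 ∈ I := by
    have : transvSL 0 0 = 1 := by decide
    rw [this]; exact I.one_mem
  have key : ∀ z : ZMod 2, z = 0 ∨ z = 1 := by decide
  have hall : transvSL 0 1 ∈ I := by
    rcases key x with rfl | rfl <;> rcases key y with rfl | rfl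
    · simp at hxy
    · exact h
    · exact h3 (h2 h)
    · exact h3 h
  rcases key a with rfl | rfl <;> rcases key b with rfl | rfl
  · exact h0
  · exact hall
  · exact h1 hall
  · exact h2 (h1 hall)

theorem exists_transvection_eq (i j : Fin 3) (hij : i ≠ j) :
    ∃ (n : Fin 7) (a b : ZMod 2),
      singer ^ (n : ℕ) * transvection i j 1 * singer ^ (7 - n : ℕ) = transv a b := by
  revert i j
  decide +kernel

/-- A Singer cycle and an involution generate `SL_3(𝔽₂)`. -/
theorem eq_top_of_singerSL_mem {I : Subgroup (SpecialLinearGroup (Fin 3) (ZMod 2))}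
    (hA : singerSL ∈ I) {τ : SpecialLinearGroup (Fin 3) (ZMod 2)} (hτ : τ ∈ I) (h2 : τ * τ = 1)
    (h1 : τ ≠ 1) : I = ⊤ := by
  have hτm : τ.1 = !![τ.1 0 0, τ.1 0 1, τ.1 0 2; τ.1 1 0, τ.1 1 1, τ.1 1 2;
      τ.1 2 0, τ.1 2 1, τ.1 2 2] := Matrix.eta_fin_three _
  obtain ⟨n, x, y, hxy, hn⟩ := exists_conj_transv (τ.1 0 0) (τ.1 0 1) (τ.1 0 2) (τ.1 1 0) (τ.1 1 1)
    (τ.1 1 2) (τ.1 2 0) (τ.1 2 1) (τ.1 2 2)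
    (by rw [← hτm]; exact congrArg Subtype.val h2)
    (by rw [← hτm]; exact fun h => h1 (Subtype.ext h))
  rw [← hτm] at hn
  have hT : transvSL x y ∈ I := by
    rw [← singerSL_pow_mul n τ x y hn]
    exact I.mul_mem (I.mul_mem (I.pow_mem hA _) hτ) (I.pow_mem hA _)
  have htr : ∀ t : TransvectionStruct (Fin 3) (ZMod 2), t.toSpecialLinearGroup ∈ I := by
    rintro ⟨i, j, hij, c⟩
    have key : ∀ z : ZMod 2, z = 0 ∨ z = 1 := by decide
    rcases key c with rfl | rfl
    · convert I.one_mem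
      apply sl_ext
      simp
    · obtain ⟨m, a, b, hm⟩ := exists_transvection_eq i j hij
      set t : SpecialLinearGroup (Fin 3) (ZMod 2) :=
        (TransvectionStruct.mk i j hij 1 :
          TransvectionStruct (Fin 3) (ZMod 2)).toSpecialLinearGroup with ht
      have hm' := singerSL_pow_mul m t a b (by rw [← hm]; rfl)
      have hab := transvSL_mem hA hxy hT a b
      rw [← hm'] at hab
      have h7 : singerSL ^ (7 - m : ℕ) ∈ I := I.pow_mem hA _
      have h7' : singerSL ^ (m : ℕ) ∈ I := I.pow_mem hA _
      rwa [I.mul_mem_cancel_right h7, I.mul_mem_cancel_left h7'] at hab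
  rw [eq_top_iff]
  intro M _
  obtain ⟨L, L', D, hM⟩ :=
    Matrix.SpecialLinearGroup.exists_list_transvec_mul_diagonal_mul_list_transvec M
  obtain ⟨hD, rfl⟩ := hM
  have hD1 : ∀ X : SpecialLinearGroup (Fin 3) (ZMod 2), X.1 = diagonal D → X ∈ I := by
    intro X hX
    have hne := Matrix.SpecialLinearGroup.diagonal_neZero D hD
    have key : ∀ z : ZMod 2, z ≠ 0 → z = 1 := by decide
    have : D = fun _ => 1 := funext fun i => key _ (hne i)
    rw [show X = 1 from sl_ext (hX.trans (by rw [this]; exact diagonal_one))]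
    exact I.one_mem
  refine I.mul_mem (I.mul_mem (I.list_prod_mem ?_) (hD1 _ rfl)) (I.list_prod_mem ?_) <;>
  · intro x hx
    obtain ⟨t, -, rfl⟩ := List.mem_map.1 hx
    exact htr t

end

/-- A group of collineations of the Fano plane that contains a Singer cycle and an involution is
isomorphic to `SL_3(𝔽₂)`. -/
theorem nonempty_mulEquiv_of_collineation {H : Type*} [Group H] (ρ : H →* Equiv.Perm (ZMod 7))
    (hρ : ∀ h, Collineation (ρ h)) (hinj : Function.Injective ρ) (s : H)
    (hs : ∀ x, ρ s x = x + 1) (τ : H) (h2 : τ * τ = 1) (h1 : τ ≠ 1) :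
    Nonempty (H ≃* Matrix.SpecialLinearGroup (Fin 3) (ZMod 2)) := by
  have hi := toSL_injective ρ hρ hinj
  refine ⟨MulEquiv.ofBijective (toSL ρ hρ) ⟨hi, ?_⟩⟩
  rw [← MonoidHom.range_eq_top]
  have hA : toSL ρ hρ s = singerSL := by
    apply sl_ext
    change mat (ρ s) = singer
    rw [← mat_add_one]
    congr 1
    funext x
    exact hs x
  refine eq_top_of_singerSL_mem (τ := toSL ρ hρ τ) ⟨s, hA⟩ ⟨τ, rfl⟩ ?_ ?_
  · rw [← map_mul, h2, map_one]
  · rw [← map_one (toSL ρ hρ)]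
    exact hi.ne h1

/-! ### Three-element subsets of `ℤ/7` and the maps permuting their translates -/

/-- The number of pairs of elements of `D` at a given distance. -/
def distCount (D : Finset (ZMod 7)) (d : ZMod 7) : ℕ :=
  (Finset.univ.filter fun x => x ∈ D ∧ x + d ∈ D).card

set_option maxRecDepth 10000 in
theorem eq_of_translate_eq (D : Finset (ZMod 7)) (hD : D.card = 3) (i j : ZMod 7)
    (h : ∀ x, x - i ∈ D ↔ x - j ∈ D) : i = j := by
  have key : ∀ D ∈ Finset.powersetCard 3 (Finset.univ : Finset (ZMod 7)), ∀ d : ZMod 7,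
      (∀ x, x ∈ D ↔ x - d ∈ D) → d = 0 := by decide +kernel
  have := key D (by simp [hD]) (j - i) fun x => by
    have := h (x + i)
    rwa [add_sub_cancel_right, show x + i - j = x - (j - i) by ring] at this
  exact (sub_eq_zero.1 this).symm

set_option synthInstance.maxHeartbeats 400000 in
set_option synthInstance.maxSize 1000 in
/-- A three-element subset of `ℤ/7` is affinely equivalent to the difference set, or some distance
occurs twice in it. -/
theorem diffSet_or_dihedral (D : Finset (ZMod 7)) (hD : D.card = 3) :
    (∃ k k' c : ZMod 7, k * k' = 1 ∧ ∀ x, x ∈ D ↔ k * x + c ∈ diffSet) ∨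
      ∃ k k' : ZMod 7, k * k' = 1 ∧ ∀ d, distCount D d = 2 ↔ d = k ∨ d = -k := by
  have key : ∀ D ∈ Finset.powersetCard 3 (Finset.univ : Finset (ZMod 7)),
    (∃ k k' c : ZMod 7, k * k' = 1 ∧ ∀ x, x ∈ D ↔ k * x + c ∈ diffSet) ∨
      ∃ k k' : ZMod 7, k * k' = 1 ∧ ∀ d, distCount D d = 2 ↔ d = k ∨ d = -k := by
    decide +kernel
  exact key D (by simp [hD])

/-- This reads `distCount` as the number of translates of `D` through two given points, a quantity
on which a permutation of the translates can be tested. -/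
theorem distCount_eq (D : Finset (ZMod 7)) (a b : ZMod 7) :
    distCount D (b - a) = (Finset.univ.filter fun i => a - i ∈ D ∧ b - i ∈ D).card := by
  refine Finset.card_bij (fun x _ => a - x) ?_ ?_ ?_
  · intro x hx
    simp only [Finset.mem_filter, Finset.mem_univ, true_and] at hx ⊢
    rw [sub_sub_cancel, show b - (a - x) = x + (b - a) by ring]
    exact hx
  · intro x _ y _ h
    exact sub_right_injective h
  · intro i hi
    simp only [Finset.mem_filter, Finset.mem_univ, true_and] at hi
    refine ⟨a - i, ?_, by ring⟩
    simp only [Finset.mem_filter, Finset.mem_univ, true_and]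
    rw [show a - i + (b - a) = b - i by ring]
    exact hi

/-- The induced map on translates is injective and sends those through `a, b` to those through `t a,
t b`. Applied also to the inverse of a permutation, it yields equality. -/
theorem PermutesTranslates.distCount_le {D : Finset (ZMod 7)} (hD : D.card = 3)
    {t : ZMod 7 → ZMod 7} (ht : PermutesTranslates D t) (a b : ZMod 7) :
    distCount D (b - a) ≤ distCount D (t b - t a) := by
  rw [distCount_eq, distCount_eq]
  choose π hπ using ht
  refine Finset.card_le_card_of_injOn π ?_ ?_
  · intro i hi
    simp only [Finset.coe_filter, Finset.mem_univ, true_and, Set.mem_ofPred_eq] at hi ⊢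
    exact ⟨(hπ i a).1 hi.1, (hπ i b).1 hi.2⟩
  · intro i _ j _ hij
    refine eq_of_translate_eq D hD i j fun x => ?_
    rw [hπ i, hπ j, hij]

/-- A walk on the heptagon that never repeats a vertex cannot turn back, so its first step
determines it. -/
theorem eq_self_of_steps {u : ZMod 7 → ZMod 7} (hu : Function.Injective u) (h0 : u 0 = 0)
    (h1 : u 1 = 1) (h : ∀ i, u (i + 1) = u i + 1 ∨ u (i + 1) = u i - 1) (i : ZMod 7) :
    u i = i := by
  have step : ∀ i, u i = i → u (i + 1) = i + 1 → u (i + 1 + 1) = i + 1 + 1 := by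
    intro i hi hi1
    rcases h (i + 1) with h' | h'
    · rw [h', hi1]
    · exfalso
      rw [hi1, add_sub_cancel_right] at h'
      have := hu (h'.trans hi.symm)
      revert this
      clear h' hi1 hi
      revert i
      decide
  have h2 : u 2 = 2 := step 0 h0 h1
  have h3 : u 3 = 3 := step 1 h1 h2
  have h4 : u 4 = 4 := step 2 h2 h3
  have h5 : u 5 = 5 := step 3 h3 h4
  have h6 : u 6 = 6 := step 4 h4 h5
  have : i = 0 ∨ i = 1 ∨ i = 2 ∨ i = 3 ∨ i = 4 ∨ i = 5 ∨ i = 6 := by revert i; decide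
  rcases this with rfl | rfl | rfl | rfl | rfl | rfl | rfl <;> assumption

/-- A symmetry of the heptagon with two fixed points is trivial. -/
theorem eq_self_of_dihedral {t : ZMod 7 → ZMod 7} (ht : Function.Injective t) {k k' : ZMod 7}
    (hk : k * k' = 1) (h : ∀ a, t (a + k) - t a = k ∨ t (a + k) - t a = -k) {a b : ZMod 7}
    (hab : a ≠ b) (ha : t a = a) (hb : t b = b) (x : ZMod 7) : t x = x := by
  have hk' : k' * k = 1 := by rw [mul_comm, hk]
  have hinjk : Function.Injective fun x : ZMod 7 => k * x := fun x y hxy => by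
    have := congrArg (fun z => k' * z) hxy
    simpa only [← mul_assoc, hk', one_mul] using this
  have hinjk' : Function.Injective fun x : ZMod 7 => k' * x := fun x y hxy => by
    have := congrArg (fun z => k * z) hxy
    simpa only [← mul_assoc, hk, one_mul] using this
  -- Recentre at the fixed point `a` and rescale so that edges of the heptagon have length 1.
  set u : ZMod 7 → ZMod 7 := fun i => k' * (t (a + k * i) - a) with hu
  have hui : Function.Injective u := fun i j hij =>
    hinjk (add_left_cancel (ht (sub_left_injective (hinjk' hij))))
  have hstep : ∀ i, u (i + 1) = u i + 1 ∨ u (i + 1) = u i - 1 := by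
    intro i
    have e : a + k * (i + 1) = a + k * i + k := by ring
    simp only [hu, e]
    rcases h (a + k * i) with h' | h'
    · left
      linear_combination k' * h' + hk
    · right
      linear_combination k' * h' - hk
  have h0 : u 0 = 0 := by simp [hu, ha]
  have htx : ∀ x, t x = a + k * u (k' * (x - a)) := by
    intro x
    simp only [hu]
    rw [← mul_assoc, ← mul_assoc, hk, one_mul, one_mul]
    ring_nf
  rcases hstep 0 with h1 | h1 <;> rw [h0, zero_add] at h1
  · rw [htx, eq_self_of_steps hui h0 (by simpa using h1) hstep]
    linear_combination (x - a) * hk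
  -- Otherwise `t` is the reflection about `a`; a second fixed point `b` gives `2 * b = 2 * a`, and
  -- 2 is invertible modulo 7.
  · exfalso
    have hneg := eq_self_of_steps (u := fun i => - u i) (neg_injective.comp hui) (by simp [h0])
      (by simp [h1]) fun i => by
        rcases hstep i with h' | h'
        · right; rw [h']; ring
        · left; rw [h']; ring
    have h3 := htx b
    rw [← neg_neg (u _), hneg, hb] at h3
    apply hab
    have h4 : 2 * b = 2 * a := by linear_combination h3 + (a - b) * hk
    revert h4
    clear * - 
    revert a b
    decide

/-- A transitive permutation group on the seven points `ℤ/7` that permutes the translates of a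
three-element set and contains an involution with two fixed points is `SL_3(𝔽₂)`. -/
theorem nonempty_mulEquiv_of_permutesTranslates {H : Type*} [Group H]
    (ρ : H →* Equiv.Perm (ZMod 7)) (hinj : Function.Injective ρ) {D : Finset (ZMod 7)}
    (hD : D.card = 3) (hρ : ∀ h, PermutesTranslates D (ρ h)) (s : H)
    (hs : ∀ x, ρ s x = x + 1) (τ : H) (h2 : τ * τ = 1) (h1 : τ ≠ 1) {a b : ZMod 7} (hab : a ≠ b)
    (ha : ρ τ a = a) (hb : ρ τ b = b) :
    Nonempty (H ≃* Matrix.SpecialLinearGroup (Fin 3) (ZMod 2)) := by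
  rcases diffSet_or_dihedral D hD with ⟨k, k', c, hk, hDk⟩ | ⟨k, k', hk, hDk⟩
  · have hk' : k' * k = 1 := by rw [mul_comm, hk]
    let A : Equiv.Perm (ZMod 7) :=
      { toFun := fun x => k * x + c
        invFun := fun y => k' * (y - c)
        left_inv := fun x => by linear_combination x * hk'
        right_inv := fun y => by linear_combination (y - c) * hk }
    have hA : ∀ x, A x = k * x + c := fun _ => rfl
    have hAs : ∀ x, A.symm x = k' * (x - c) := fun _ => rfl
    let ρ' : H →* Equiv.Perm (ZMod 7) := (MulAut.conj A).toMonoidHom.comp ρ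
    have hρ' : ∀ h x, ρ' h x = A (ρ h (A.symm x)) := fun _ _ => rfl
    have hs' : ∀ (n : ℕ) x, ρ (s ^ n) x = x + n := by
      intro n
      induction n with
      | zero => intro x; simp
      | succ n ih =>
        intro x
        rw [pow_succ, map_mul, Equiv.Perm.mul_apply, hs, ih]
        push_cast
        ring
    -- After conjugation by `x ↦ k * x + c`, the translation by `k'` becomes translation by `k * k'
    -- = 1`.
    refine nonempty_mulEquiv_of_collineation ρ' (fun h i => ?_) ?_ (s ^ k'.val) (fun x => ?_) τ h2
      h1
    · obtain ⟨j, hj⟩ := hρ h (k' * i)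
      refine ⟨k * j, fun y => ?_⟩
      have := hj (A.symm y)
      rw [hDk, hDk] at this
      rw [hρ', hA, show k * (A.symm y - k' * i) + c = y - i by
        rw [hAs]; linear_combination (y - c - i) * hk] at *
      rw [this, show ∀ z, k * (z - j) + c = k * z + c - k * j by intro z; ring]
    · exact (MulAut.conj A).injective.comp hinj
    · rw [hρ', hs', hA, hAs, ZMod.natCast_zmod_val]
      linear_combination (x - c + 1) * hk
  -- The pairs at distance `±k` are those lying on exactly two translates, so `τ` preserves the
  -- heptagon they form.
  · exfalso
    apply h1
    apply hinj
    rw [map_one]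
    apply Equiv.ext
    have hcount : ∀ x y, distCount D (ρ τ y - ρ τ x) = distCount D (y - x) := by
      intro x y
      apply le_antisymm
      · have := (hρ τ⁻¹).distCount_le hD (ρ τ x) (ρ τ y)
        simpa using this
      · exact (hρ τ).distCount_le hD x y
    refine eq_self_of_dihedral (ρ τ).injective hk (fun x => ?_) hab ha hb
    rw [← hDk, hcount, hDk]
    left; ring

end Fano

/-! ### Recognising `SL_3(𝔽₂)` from an action on seven points -/

namespace Fano

/-- An element of order 7 acting faithfully on seven points acts as a 7-cycle. -/
theorem exists_equiv_zmod {H Ω : Type*} [Group H] [MulAction H Ω] [FaithfulSMul H Ω]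
    (hcard : Nat.card Ω = 7) (s : H) (hs : orderOf s = 7) :
    ∃ e : ZMod 7 ≃ Ω, ∀ i, s • e i = e (i + 1) := by
  have : Finite Ω := Nat.finite_of_card_ne_zero (by rw [hcard]; norm_num)
  have h7 : s ^ 7 = 1 := by rw [← hs]; exact pow_orderOf_eq_one s
  obtain ⟨x, hx⟩ : ∃ x : Ω, s • x ≠ x := by
    by_contra! h
    have : s = 1 := FaithfulSMul.eq_of_smul_eq_smul fun x : Ω => by rw [h x, one_smul]
    rw [this, orderOf_one] at hs
    norm_num at hs
  have hper : Function.minimalPeriod (s • · : Ω → Ω) x = 7 := by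
    apply Function.minimalPeriod_eq_prime (hp := ⟨by norm_num⟩)
    · change (s • ·)^[7] x = x
      simp only [smul_iterate, h7, one_smul]
    · exact hx
  have hinj : Function.Injective fun i : ZMod 7 => s ^ i.val • x := by
    intro i j hij
    apply ZMod.val_injective
    have := Function.iterate_injOn_Iio_minimalPeriod (f := (s • · : Ω → Ω)) (x := x)
    rw [hper] at this
    refine this (ZMod.val_lt i) (ZMod.val_lt j) ?_
    simpa only [smul_iterate] using hij
  refine ⟨Equiv.ofBijective _ ((Nat.bijective_iff_injective_and_card _).2 ⟨hinj, ?_⟩), fun i => ?_⟩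
  · rw [hcard, Nat.card_zmod]
  · simp only [Equiv.ofBijective_apply]
    rw [← mul_smul, ← pow_succ', ZMod.val_add, ← Nat.mod_add_div (i.val + 1) 7, pow_add, pow_mul,
      h7, one_pow, mul_one]
    congr 2

/-- A transitive permutation group on seven points that contains an involution with two fixed
points, and for which some three-element set has at most seven images, is `SL_3(𝔽₂)`. -/
theorem nonempty_mulEquiv_of_mulAction {H Ω : Type*} [Group H] [MulAction H Ω] [FaithfulSMul H Ω]
    [MulAction.IsPretransitive H Ω] (hcard : Nat.card Ω = 7) (L : Set Ω) (hL : L.ncard = 3)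
    (horb : (Set.range fun h : H => (fun x => h • x) '' L).ncard ≤ 7) (τ : H) (h2 : τ * τ = 1)
    (h1 : τ ≠ 1) {a b : Ω} (hab : a ≠ b) (ha : τ • a = a) (hb : τ • b = b) :
    Nonempty (H ≃* Matrix.SpecialLinearGroup (Fin 3) (ZMod 2)) := by
  classical
  have : Finite Ω := Nat.finite_of_card_ne_zero (by rw [hcard]; norm_num)
  have : Finite H := Finite.of_injective _ (MulAction.toPerm_injective (α := H) (β := Ω))
  have h7 : 7 ∣ Nat.card H := by
    rw [← hcard, ← MulAction.index_stabilizer_of_transitive H a]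
    exact Subgroup.index_dvd_card _
  obtain ⟨s, hs⟩ := exists_prime_orderOf_dvd_card' (hp := ⟨by norm_num⟩) 7 h7
  obtain ⟨e, he⟩ := exists_equiv_zmod hcard s hs
  have hepow : ∀ (n : ℕ) i, s ^ n • e i = e (i + n) := by
    intro n
    induction n with
    | zero => intro i; simp
    | succ n ih =>
      intro i
      rw [pow_succ', mul_smul, ih, he]
      push_cast
      ring_nf
  let ρ : H →* Equiv.Perm (ZMod 7) :=
    (Equiv.permCongrHom e.symm).toMonoidHom.comp (MulAction.toPermHom H Ω)
  have hρ : ∀ h i, ρ h i = e.symm (h • e i) := fun _ _ => rfl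
  have hρe : ∀ h i, e (ρ h i) = h • e i := fun h i => by rw [hρ, e.apply_symm_apply]
  let D : Finset (ZMod 7) := Finset.univ.filter fun i => e i ∈ L
  have hDmem : ∀ i, i ∈ D ↔ e i ∈ L := fun i => by simp [D]
  have hD : D.card = 3 := by
    rw [← Set.ncard_coe_finset, ← hL]
    refine Set.ncard_congr (fun i _ => e i) ?_ ?_ ?_
    · intro i hi; exact (hDmem i).1 hi
    · intro i j _ _ h; exact e.injective h
    · intro x hx; exact ⟨e.symm x, by simpa [hDmem] using hx, by simp⟩
  have hmem : ∀ (h : H) x, x ∈ (fun x => h • x) '' L ↔ h⁻¹ • x ∈ L := fun h x =>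
    Set.mem_smul_set_iff_inv_smul_mem
  let T : ZMod 7 → Set Ω := fun j => (fun x => s ^ j.val • x) '' L
  have hT : ∀ j x, e x ∈ T j ↔ x - j ∈ D := by
    intro j x
    rw [hDmem, hmem]
    have : (s ^ j.val)⁻¹ • e x = e (x - j) := by
      rw [inv_smul_eq_iff, hepow, ZMod.natCast_zmod_val, sub_add_cancel]
    rw [this]
  have hTinj : Function.Injective T := by
    intro i j hij
    refine eq_of_translate_eq D hD i j fun x => ?_
    rw [← hT, ← hT, hij]
  -- The seven distinct translates already exhaust the at most seven images of `L`.
  have hrange : Set.range T = Set.range fun h : H => (fun x => h • x) '' L := by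
    apply Set.eq_of_subset_of_ncard_le
    · rintro _ ⟨j, rfl⟩
      exact ⟨s ^ j.val, rfl⟩
    · refine horb.trans (le_of_eq ?_)
      rw [← Set.image_univ, Set.ncard_image_of_injective _ hTinj, Set.ncard_univ, Nat.card_zmod]
    · exact Set.toFinite _
  refine nonempty_mulEquiv_of_permutesTranslates ρ ?_ hD (fun h i => ?_) s (fun x => ?_) τ h2 h1
    (a := e.symm a) (b := e.symm b) (e.symm.injective.ne hab) ?_ ?_
  · exact (Equiv.permCongrHom e.symm).injective.comp MulAction.toPerm_injective
  · have hmemr : (fun x => (h * s ^ i.val) • x) '' L ∈ Set.range T := by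
      rw [hrange]; exact ⟨_, rfl⟩
    obtain ⟨j, hj⟩ := hmemr
    refine ⟨j, fun x => ?_⟩
    rw [← hT, ← hT, hj, hρe, hmem, hmem, mul_inv_rev, mul_smul, inv_smul_smul]
  · rw [hρ, he, e.symm_apply_apply]
  · rw [hρ, e.apply_symm_apply, ha]
  · rw [hρ, e.apply_symm_apply, hb]

end Fano

/-- For matrices over `𝔽₂` of odd size, `SL` and `PSL` agree. -/
theorem nonempty_mulEquiv_PSL_three_two :
    Nonempty (Matrix.SpecialLinearGroup (Fin 3) (ZMod 2) ≃*
      Matrix.ProjectiveSpecialLinearGroup (Fin 3) (ZMod 2)) := by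
  have h : Subgroup.center (Matrix.SpecialLinearGroup (Fin 3) (ZMod 2)) = ⊥ := by
    rw [eq_bot_iff]
    intro A hA
    obtain ⟨r, hr, hA⟩ := Matrix.SpecialLinearGroup.mem_center_iff.1 hA
    have hr1 : r = 1 := by
      revert hr
      clear hA
      revert r
      decide
    rw [Subgroup.mem_bot]
    apply Fano.sl_ext
    rw [← hA, hr1]
    simp
  exact ⟨(QuotientGroup.quotientBot.symm.trans (QuotientGroup.quotientMulEquivOfEq h.symm))⟩

/-! ### A polynomial of degree 7 with Galois group `PSL_3(2)` -/

namespace Trinks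

open Polynomial

/-- The polynomial `X ^ 7 - 7 X + 3`. -/
noncomputable def poly (R : Type*) [CommRing R] : R[X] := X ^ 7 - C 7 * X + C 3

theorem map_poly {R S : Type*} [CommRing R] [CommRing S] (φ : R →+* S) :
    (poly R).map φ = poly S := by
  simp [poly, map_ofNat]

theorem natDegree_poly (R : Type*) [CommRing R] [Nontrivial R] : (poly R).natDegree = 7 := by
  rw [poly]; compute_degree!

theorem monic_poly (R : Type*) [CommRing R] [Nontrivial R] : (poly R).Monic := by
  rw [poly]; monicity!

theorem eval_poly {R : Type*} [CommRing R] (x : R) : (poly R).eval x = x ^ 7 - 7 * x + 3 := by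
  simp [poly]

theorem aeval_poly {R A : Type*} [CommRing R] [CommRing A] [Algebra R A] (x : A) :
    aeval x (poly R) = x ^ 7 - 7 * x + 3 := by
  simp [poly, map_ofNat]

/-- Modulo 7 the polynomial is `(X + 3) ^ 7`, so the shift `X ↦ X - 3` makes it Eisenstein at 7. -/
theorem irreducible_poly_int : Irreducible (poly ℤ) := by
  have hshift : algEquivAevalXAddC (-3 : ℤ) (poly ℤ) = X ^ 7 + C (-21) * X ^ 6 + C 189 * X ^ 5 +
      C (-945) * X ^ 4 + C 2835 * X ^ 3 + C (-5103) * X ^ 2 + C 5096 * X + C (-2163) := by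
    simp [poly, map_ofNat]
    ring
  rw [← MulEquiv.irreducible_iff (algEquivAevalXAddC (-3 : ℤ)), hshift]
  set g : ℤ[X] := X ^ 7 + C (-21) * X ^ 6 + C 189 * X ^ 5 +
      C (-945) * X ^ 4 + C 2835 * X ^ 3 + C (-5103) * X ^ 2 + C 5096 * X + C (-2163) with hg
  have hdeg : g.natDegree = 7 := by rw [hg]; compute_degree!
  have hmon : g.Monic := by rw [hg]; monicity!
  have heis : g.IsEisensteinAt (Ideal.span {7}) := by
    refine ⟨?_, ?_, ?_⟩
    · rw [hmon.leadingCoeff, Ideal.mem_span_singleton]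
      norm_num
    · intro n hn
      rw [hdeg] at hn
      rw [Ideal.mem_span_singleton]
      interval_cases n <;> simp [hg, coeff_X]
    · rw [Ideal.span_singleton_pow, Ideal.mem_span_singleton]
      simp [hg]
  refine heis.irreducible ?_ hmon.isPrimitive (by rw [hdeg]; norm_num)
  rw [Ideal.span_singleton_prime (by norm_num)]
  exact Int.prime_iff_natAbs_prime.2 (by norm_num)

theorem irreducible_poly : Irreducible (poly ℚ) := by
  rw [← map_poly (Int.castRingHom ℚ)]
  exact (monic_poly ℤ).irreducible_iff_irreducible_map_fraction_map.1 irreducible_poly_int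

/-- The resolvent for the sums of the roots over the lines. -/
noncomputable def resolvent (R : Type*) [CommRing R] : R[X] :=
  X ^ 7 + C 14 * X ^ 4 - C 42 * X ^ 2 - C 21 * X + C 9

theorem natDegree_resolvent (R : Type*) [CommRing R] [Nontrivial R] :
    (resolvent R).natDegree = 7 := by
  rw [resolvent]; compute_degree!

theorem map_resolvent {R S : Type*} [CommRing R] [CommRing S] (φ : R →+* S) :
    (resolvent R).map φ = resolvent S := by
  simp [resolvent, map_ofNat]

section
variable {E : Type*} [Field E]

/-- The second elementary symmetric function of the roots on a line, in terms of the first. -/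
def esymmTwo (d : E) : E :=
  23 / 3 * d ^ 6 - 12 * d ^ 5 + 19 * d ^ 4 + 232 / 3 * d ^ 3 - 120 * d ^ 2 - 131 * d + 42

/-- The third elementary symmetric function of the roots on a line, in terms of the first. -/
def esymmThree (d : E) : E :=
  -(32 / 3) * d ^ 6 + 17 * d ^ 5 - 27 * d ^ 4 - 319 / 3 * d ^ 3 + 170 * d ^ 2 + 178 * d - 61

/-- The cubic factor of the polynomial attached to a root of the resolvent. -/
noncomputable def cubic (d : E) : E[X] :=
  X ^ 3 - C d * X ^ 2 + C (esymmTwo d) * X - C (esymmThree d)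

theorem eval_cubic (d x : E) :
    (cubic d).eval x = x ^ 3 - d * x ^ 2 + esymmTwo d * x - esymmThree d := by
  simp [cubic]

theorem natDegree_cubic (d : E) : (cubic d).natDegree = 3 := by
  rw [cubic]; compute_degree!

theorem monic_cubic (d : E) : (cubic d).Monic := by
  rw [cubic]; monicity!

theorem cubic_dvd_poly [Algebra ℚ E] (d : E) (hd : (resolvent E).eval d = 0) : cubic d ∣ poly E := by
  have : CharZero E := algebraRat.charZero E
  have hd' : d ^ 7 + 14 * d ^ 4 - 42 * d ^ 2 - 21 * d + 9 = 0 := by simpa [resolvent] using hd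
  refine ⟨X ^ 4 + C d * X ^ 3 + C (-(23 / 3) * d ^ 6 + 12 * d ^ 5 - 19 * d ^ 4 - 232 / 3 * d ^ 3
    + 121 * d ^ 2 + 131 * d - 42) * X ^ 2 + C (40 / 3 * d ^ 6 - 21 * d ^ 5 + 33 * d ^ 4
    + 404 / 3 * d ^ 3 - 212 * d ^ 2 - 228 * d + 77) * X + C (-(14 / 3) * d ^ 6 + 7 * d ^ 5
    - 11 * d ^ 4 - 145 / 3 * d ^ 3 + 71 * d ^ 2 + 84 * d - 24), ?_⟩
  refine Polynomial.funext fun x => ?_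
  simp only [eval_mul, eval_cubic, eval_poly, eval_add, eval_pow, eval_X, eval_C, esymmTwo,
    esymmThree]
  -- The explicit quartic comes from dividing by the cubic; each coefficient of the difference is a
  -- multiple of the resolvent in `d`, and the cofactors are listed here.
  linear_combination (-(46 / 3 * x ^ 4 + (-(529 / 9) * d ^ 5 + 184 * d ^ 4 - 1306 / 3 * d ^ 3
    + 838 / 9 * d ^ 2 + 2300 / 3 * d - 596 / 3) * x ^ 3 + (184 / 9 * d ^ 5 - 188 / 3 * d ^ 4
    + 434 / 3 * d ^ 3 - 97 / 9 * d ^ 2 - 868 / 3 * d + 224 / 3) * x ^ 2 + (958 / 9 * d ^ 5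
    - 341 * d ^ 4 + 812 * d ^ 3 - 2074 / 9 * d ^ 2 - 4106 / 3 * d + 1232 / 3) * x
    + (-(448 / 9) * d ^ 5 + 154 * d ^ 4 - 1087 / 3 * d ^ 3 + 550 / 9 * d ^ 2 + 1991 / 3 * d
    - 163))) * hd'
end

theorem separable_poly (E : Type*) [Field E] [Algebra ℚ E] : (poly E).Separable := by
  rw [← map_poly (algebraMap ℚ E)]
  exact irreducible_poly.separable.map

/-- Over a field over which the polynomial splits, the resolvent has a root. -/
theorem exists_root_resolvent (E : Type*) [Field E] [Algebra ℚ E] (h : (poly E).Splits) :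
    ∃ d : E, (resolvent E).eval d = 0 ∧ ((cubic d).rootSet E).ncard = 3 := by
  -- A root `δ` is first found in the closure. It is the sum of the roots of `cubic δ`, which are
  -- roots of the split polynomial and so lie in `E`; hence `δ` does too.
  let A := AlgebraicClosure E
  obtain ⟨δ, hδ⟩ : ∃ δ : A, (resolvent A).eval δ = 0 := by
    refine IsAlgClosed.exists_root _ (ne_of_gt ?_)
    rw [← natDegree_pos_iff_degree_pos, natDegree_resolvent]
    norm_num
  have hdvd := cubic_dvd_poly δ hδ
  have hroot : ∀ x ∈ (cubic δ).roots, x ∈ (algebraMap E A).range := by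
    intro x hx
    have hx' : x ∈ ((poly E).map (algebraMap E A)).roots := by
      rw [map_poly]
      exact Multiset.mem_of_le (roots.le_of_dvd (monic_poly A).ne_zero hdvd) hx
    rw [h.roots_map] at hx'
    obtain ⟨y, -, rfl⟩ := Multiset.mem_map.1 hx'
    exact ⟨y, rfl⟩
  obtain ⟨d, rfl⟩ : δ ∈ (algebraMap E A).range := by
    have hsum := (IsAlgClosed.splits (cubic δ)).nextCoeff_eq_neg_sum_roots_of_monic (monic_cubic δ)
    have : (cubic δ).nextCoeff = -δ := by
      rw [nextCoeff_of_natDegree_pos (by rw [natDegree_cubic]; norm_num), natDegree_cubic]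
      simp [cubic]
    rw [this, neg_inj] at hsum
    rw [hsum]
    exact multiset_sum_mem _ hroot
  have hd : (resolvent E).eval d = 0 := by
    apply (algebraMap E A).injective
    rw [map_zero, ← hδ, ← map_resolvent (algebraMap E A), eval_map_apply]
  refine ⟨d, hd, ?_⟩
  have hdvd' := cubic_dvd_poly d hd
  rw [← Nat.card_coe_set_eq, Nat.card_eq_fintype_card, card_rootSet_eq_natDegree, natDegree_cubic]
  · exact (separable_poly E).of_dvd hdvd'
  · rw [Algebra.algebraMap_self, map_id]
    exact h.of_dvd (monic_poly E).ne_zero hdvd'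

theorem two_le_card_real_roots : ∃ x y : ℝ, x ≠ y ∧ (poly ℝ).eval x = 0 ∧ (poly ℝ).eval y = 0 := by
  have hcont : Continuous fun x : ℝ => (poly ℝ).eval x := (poly ℝ).continuous
  obtain ⟨x, hx, hx0⟩ := intermediate_value_Icc (by norm_num : (-2 : ℝ) ≤ 0) hcont.continuousOn
    (show (0 : ℝ) ∈ Set.Icc _ _ by simp only [eval_poly]; norm_num)
  obtain ⟨y, hy, hy0⟩ := intermediate_value_Icc' (by norm_num : (0 : ℝ) ≤ 1) hcont.continuousOn
    (show (0 : ℝ) ∈ Set.Icc _ _ by simp only [eval_poly]; norm_num)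
  refine ⟨x, y, ?_, hx0, hy0⟩
  rintro rfl
  have : x = 0 := le_antisymm hx.2 hy.1
  subst this
  simp [eval_poly] at hx0

/-- By Rolle's theorem: the derivative `7 (x ^ 6 - 1)` has only `±1` as real roots, leaving at most
three for the polynomial. -/
theorem card_real_roots_lt : ((poly ℝ).rootSet ℝ).ncard < 7 := by
  have h := card_rootSet_le_derivative (poly ℝ)
  have hsub : (derivative (poly ℝ)).rootSet ℝ ⊆ {1, -1} := by
    intro x hx
    have hx' := (mem_rootSet.1 hx).2
    have hx6 : x ^ 6 = 1 := by
      simp [poly] at hx'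
      linarith
    have : (x ^ 2 - 1) * (x ^ 4 + x ^ 2 + 1) = 0 := by linear_combination hx6
    rcases mul_eq_zero.1 this with h0 | h0
    · rcases sq_eq_one_iff.1 (sub_eq_zero.1 h0) with h1 | h1 <;> simp [h1]
    · nlinarith [sq_nonneg (x ^ 2), sq_nonneg x]
  rw [← Nat.card_eq_fintype_card, ← Nat.card_eq_fintype_card, Nat.card_coe_set_eq,
    Nat.card_coe_set_eq] at h
  have h2 : ((derivative (poly ℝ)).rootSet ℝ).ncard ≤ 2 :=
    (Set.ncard_le_ncard hsub (Set.toFinite _)).trans ((Set.ncard_insert_le _ _).trans (by simp))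
  omega

theorem mem_rootSet_poly {E : Type*} [Field E] [Algebra ℚ E] (x : E) :
    x ∈ (poly ℚ).rootSet E ↔ (poly E).eval x = 0 := by
  rw [mem_rootSet_of_ne (monic_poly ℚ).ne_zero, aeval_poly, eval_poly]

section
variable (E : Type*) [Field E] [Algebra ℚ E]

theorem splits_poly [IsSplittingField ℚ E (poly ℚ)] : (poly E).Splits := by
  rw [← map_poly (algebraMap ℚ E)]
  exact IsSplittingField.splits E (poly ℚ)

theorem normal_of_isSplittingField [IsSplittingField ℚ E (poly ℚ)] : Normal ℚ E := Normal.of_isSplittingField (poly ℚ)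

variable {E}

theorem coe_smul (h : Gal(E/ℚ)) (x : (poly ℚ).rootSet E) :
    ((h • x : (poly ℚ).rootSet E) : E) = h (x : E) := rfl

instance [IsSplittingField ℚ E (poly ℚ)] : FaithfulSMul Gal(E/ℚ) ((poly ℚ).rootSet E) where
  eq_of_smul_eq_smul {g h} hgh := by
    have := IsSplittingField.adjoin_rootSet E (poly ℚ)
    apply AlgEquiv.coe_toAlgHom_injective
    refine AlgHom.ext_of_adjoin_eq_top this fun x hx => ?_
    exact congrArg Subtype.val (hgh ⟨x, hx⟩)

instance [IsSplittingField ℚ E (poly ℚ)] :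
    MulAction.IsPretransitive Gal(E/ℚ) ((poly ℚ).rootSet E) where
  exists_smul_eq x y := by
    have := normal_of_isSplittingField E
    have hx := minpoly.eq_of_irreducible irreducible_poly (mem_rootSet.mp x.2).2
    have hy := minpoly.eq_of_irreducible irreducible_poly (mem_rootSet.mp y.2).2
    obtain ⟨g, hg⟩ := (Normal.minpoly_eq_iff_mem_orbit E).mp (hy.symm.trans hx)
    exact ⟨g, Subtype.ext hg⟩

variable (E) in
theorem ncard_rootSet_poly [IsSplittingField ℚ E (poly ℚ)] :
    Nat.card ((poly ℚ).rootSet E) = 7 := by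
  rw [Nat.card_eq_fintype_card, card_rootSet_eq_natDegree irreducible_poly.separable
    (IsSplittingField.splits E (poly ℚ)), natDegree_poly]

/-- The roots of the cubic factor belonging to a root `d` of the resolvent. -/
def line (d : E) : Set ((poly ℚ).rootSet E) := {x | (cubic d).eval (x : E) = 0}

theorem map_esymmTwo {E : Type*} [Field E] (h : E ≃+* E) (d : E) :
    h (esymmTwo d) = esymmTwo (h d) := by
  simp [esymmTwo, map_ofNat]

theorem map_esymmThree {E : Type*} [Field E] (h : E ≃+* E) (d : E) :
    h (esymmThree d) = esymmThree (h d) := by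
  simp [esymmThree, map_ofNat]

theorem eval_cubic_map {E : Type*} [Field E] (h : E ≃+* E) (d x : E) :
    (cubic (h d)).eval (h x) = h ((cubic d).eval x) := by
  simp [eval_cubic, map_esymmTwo, map_esymmThree]

theorem image_line (h : Gal(E/ℚ)) (d : E) :
    (fun x => h • x) '' line d = line (h d) := by
  have key : ∀ x : (poly ℚ).rootSet E, h • x ∈ line (h d) ↔ x ∈ line d := by
    intro x
    change (cubic (h d)).eval (h (x : E)) = 0 ↔ (cubic d).eval (x : E) = 0
    have := eval_cubic_map (AlgEquiv.toRingEquiv h) d (x : E)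
    change (cubic (h d)).eval (h (x : E)) = h ((cubic d).eval (x : E)) at this
    rw [this]
    exact map_eq_zero_iff _ (AlgEquiv.injective h)
  ext y
  constructor
  · rintro ⟨x, hx, rfl⟩
    exact (key x).2 hx
  · intro hy
    refine ⟨h⁻¹ • y, (key _).1 ?_, smul_inv_smul h y⟩
    rwa [smul_inv_smul]

theorem ncard_line {d : E} (hd : (resolvent E).eval d = 0)
    (h3 : ((cubic d).rootSet E).ncard = 3) : (line d).ncard = 3 := by
  have hmem : ∀ x, x ∈ (cubic d).rootSet E ↔ (cubic d).eval x = 0 := fun x => by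
    rw [mem_rootSet_of_ne (monic_cubic d).ne_zero, coe_aeval_eq_eval]
  rw [← h3]
  refine Set.ncard_congr (fun x _ => (x : E)) ?_ ?_ ?_
  · intro x hx
    exact (hmem _).2 hx
  · intro x y _ _ hxy
    exact Subtype.ext hxy
  · intro x hx
    have hx' := (hmem x).1 hx
    refine ⟨⟨x, (mem_rootSet_poly x).2 ?_⟩, hx', rfl⟩
    obtain ⟨q, hq⟩ := cubic_dvd_poly d hd
    rw [hq, eval_mul, hx', zero_mul]

theorem ncard_range_line_le {d : E} (hd : (resolvent E).eval d = 0) :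
    (Set.range fun h : Gal(E/ℚ) => (fun x => h • x) '' line d).ncard ≤ 7 := by
  classical
  have hne : resolvent E ≠ 0 := fun h => by
    have := natDegree_resolvent E
    rw [h] at this
    simp at this
  have hsub : (Set.range fun h : Gal(E/ℚ) => (fun x => h • x) '' line d) ⊆
      line '' ((resolvent E).roots.toFinset : Set E) := by
    rintro _ ⟨h, rfl⟩
    refine ⟨h d, ?_, (image_line h d).symm⟩
    rw [Finset.mem_coe, Multiset.mem_toFinset, mem_roots hne, IsRoot]
    rw [← map_resolvent (AlgEquiv.toRingEquiv h : E →+* E)]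
    change eval ((AlgEquiv.toRingEquiv h : E →+* E) d) _ = 0
    rw [eval_map_apply, hd, map_zero]
  refine (Set.ncard_le_ncard hsub (Set.toFinite _)).trans ((Set.ncard_image_le).trans ?_)
  rw [Set.ncard_coe_finset]
  exact (Multiset.toFinset_card_le _).trans ((card_roots' _).trans (natDegree_resolvent E).le)

variable (E) in
/-- The Galois group of `X ^ 7 - 7 X + 3` over `ℚ` is `SL_3(𝔽₂)`. -/
theorem nonempty_gal_mulEquiv [IsSplittingField ℚ E (poly ℚ)] :
    Nonempty (Gal(E/ℚ) ≃* Matrix.SpecialLinearGroup (Fin 3) (ZMod 2)) := by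
  obtain ⟨d, hd, hd3⟩ := exists_root_resolvent E (splits_poly E)
  let ι₀ : E →ₐ[ℚ] ℂ := IsSplittingField.lift E (poly ℚ) (IsAlgClosed.splits _)
  let _ : Algebra E ℂ := ι₀.toRingHom.toAlgebra
  have : IsScalarTower ℚ E ℂ := IsScalarTower.of_algebraMap_eq fun x => (ι₀.commutes x).symm
  have := normal_of_isSplittingField E
  let ι : E →+* ℂ := algebraMap E ℂ
  -- Complex conjugation fixes the two real roots found above, and is non-trivial because not all
  -- seven roots are real.
  let τ : Gal(E/ℚ) := (Complex.conjAe.restrictScalars ℚ).restrictNormal E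
  have hτ : ∀ x : E, ι (τ x) = (starRingEnd ℂ) (ι x) := fun x =>
    AlgEquiv.restrictNormal_commutes (Complex.conjAe.restrictScalars ℚ) E x
  have hreal : ∀ r : ℝ, (poly ℝ).eval r = 0 →
      ∃ x : (poly ℚ).rootSet E, ι x = r ∧ τ • x = x := by
    intro r hr
    have hrC : IsRoot ((poly E).map ι) (r : ℂ) := by
      rw [map_poly, ← map_poly Complex.ofRealHom, IsRoot]
      change eval (Complex.ofRealHom r) _ = 0
      rw [eval_map_apply, hr, map_zero]
    obtain ⟨x, hx⟩ := (splits_poly E).mem_range_of_isRoot (monic_poly E).ne_zero hrC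
    refine ⟨⟨x, (mem_rootSet_poly x).2 ?_⟩, hx, ?_⟩
    · apply ι.injective
      rw [← eval_map_apply, hx, map_zero]
      exact hrC
    · apply Subtype.ext
      apply ι.injective
      rw [coe_smul, hτ, hx, Complex.conj_ofReal]
  obtain ⟨r, r', hrr', hr, hr'⟩ := two_le_card_real_roots
  obtain ⟨a, ha, hτa⟩ := hreal r hr
  obtain ⟨b, hb, hτb⟩ := hreal r' hr'
  refine Fano.nonempty_mulEquiv_of_mulAction (ncard_rootSet_poly E) (line d) (ncard_line hd hd3)
    (ncard_range_line_le hd) τ ?_ ?_ (a := a) (b := b) ?_ hτa hτb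
  · ext x
    apply ι.injective
    change ι (τ (τ x)) = ι x
    rw [hτ, hτ, Complex.conj_conj]
  · intro h1
    have him : ∀ x : E, ((ι x).re : ℂ) = ι x := by
      intro x
      rw [← Complex.conj_eq_iff_re, ← hτ, h1]
      rfl
    have hle : Nat.card ((poly ℚ).rootSet E) ≤ ((poly ℝ).rootSet ℝ).ncard := by
      rw [Nat.card_coe_set_eq]
      refine Set.ncard_le_ncard_of_injOn (fun x => (ι x).re) ?_ ?_ (Set.toFinite _)
      · intro x hx
        rw [mem_rootSet_of_ne (monic_poly ℝ).ne_zero, coe_aeval_eq_eval]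
        apply Complex.ofRealHom.injective
        rw [← eval_map_apply, map_poly, map_zero]
        change eval (((ι x).re : ℝ) : ℂ) _ = 0
        rw [him, ← map_poly ι, eval_map_apply, (mem_rootSet_poly x).1 hx, map_zero]
      · intro x _ y _ hxy
        apply ι.injective
        rw [← him x, ← him y]
        exact congrArg _ hxy
    rw [ncard_rootSet_poly E] at hle
    exact absurd card_real_roots_lt (not_lt.2 hle)
  · rintro rfl
    exact hrr' (by exact_mod_cast ha.symm.trans hb)

end

end Trinks

/-- `PSL_3(2)` is a Galois group over `ℚ`. -/
theorem exists_galois_PSL_three_two :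
    ∃ (M : Type) (_ : Field M) (_ : NumberField M), IsGalois ℚ M ∧
      Nonempty (Gal(M/ℚ) ≃* Matrix.ProjectiveSpecialLinearGroup (Fin 3) (ZMod 2)) := by
  have key : ∀ (E : Type) (_ : Field E) (_ : CharZero E)
      (_ : Polynomial.IsSplittingField ℚ E (Trinks.poly ℚ)),
      ∃ _ : NumberField E, IsGalois ℚ E ∧
        Nonempty (Gal(E/ℚ) ≃* Matrix.ProjectiveSpecialLinearGroup (Fin 3) (ZMod 2)) := by
    intro E _ _ _
    have hfin : FiniteDimensional ℚ E :=
      Polynomial.IsSplittingField.finiteDimensional E (Trinks.poly ℚ)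
    obtain ⟨e⟩ := Trinks.nonempty_gal_mulEquiv E
    obtain ⟨e'⟩ := nonempty_mulEquiv_PSL_three_two
    exact ⟨⟨⟩, IsGalois.of_separable_splitting_field Trinks.irreducible_poly.separable,
      ⟨e.trans e'⟩⟩
  -- Any two `ℚ`-algebra structures on a ring coincide, which lets the splitting field carry the one
  -- coming from characteristic zero.
  have hsplit : Polynomial.IsSplittingField ℚ (Trinks.poly ℚ).SplittingField (Trinks.poly ℚ) := by
    convert Polynomial.IsSplittingField.splittingField (Trinks.poly ℚ)
    exact Subsingleton.elim _ _
  exact ⟨_, _, key _ _ (algebraRat.charZero _) hsplit⟩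

/-! ### Stabilizers of lines and hyperplanes in `SL_d` and `PSL_d` -/

section Stabilizers

open Matrix

variable {d : ℕ} {F : Type*} [Field F]

theorem mem_slStabilizer_iff {W : Submodule F (Fin d → F)}
    {A : Matrix.SpecialLinearGroup (Fin d) F} :
    A ∈ slStabilizer W ↔ W.map (Matrix.SpecialLinearGroup.toLin' A).toLinearMap = W := Iff.rfl

theorem mem_slStabilizer_of_le {W : Submodule F (Fin d → F)}
    {A : Matrix.SpecialLinearGroup (Fin d) F} (h : ∀ x ∈ W, A.1 *ᵥ x ∈ W) : A ∈ slStabilizer W := by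
  rw [mem_slStabilizer_iff]
  apply Submodule.eq_of_le_of_finrank_eq
  · rintro _ ⟨x, hx, rfl⟩
    exact h x hx
  · exact LinearEquiv.finrank_map_eq (Matrix.SpecialLinearGroup.toLin' A) W

theorem mulVec_mem_of_mem_slStabilizer {W : Submodule F (Fin d → F)}
    {A : Matrix.SpecialLinearGroup (Fin d) F} (h : A ∈ slStabilizer W) {x : Fin d → F}
    (hx : x ∈ W) : A.1 *ᵥ x ∈ W := by
  rw [mem_slStabilizer_iff] at h
  rw [← h]
  exact ⟨x, hx, rfl⟩

theorem center_le_slStabilizer (W : Submodule F (Fin d → F)) :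
    Subgroup.center (Matrix.SpecialLinearGroup (Fin d) F) ≤ slStabilizer W := by
  intro A hA
  obtain ⟨r, -, hr⟩ := Matrix.SpecialLinearGroup.mem_center_iff.1 hA
  refine mem_slStabilizer_of_le fun x hx => ?_
  rw [← hr, Matrix.scalar_apply, ← Matrix.smul_one_eq_diagonal, Matrix.smul_mulVec,
    Matrix.one_mulVec]
  exact W.smul_mem r hx

/-- The stabilizer in `SL_d` contains the centre, so it is the full preimage of its image;
membership can be tested on matrices. -/
theorem mk_mem_pslStabilizer {W : Submodule F (Fin d → F)}
    {A : Matrix.SpecialLinearGroup (Fin d) F} :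
    (QuotientGroup.mk' (Subgroup.center _) A) ∈ pslStabilizer W ↔ A ∈ slStabilizer W := by
  constructor
  · rintro ⟨B, hB, hBA⟩
    have : B⁻¹ * A ∈ Subgroup.center _ := (QuotientGroup.eq).1 hBA
    have h := (slStabilizer W).mul_mem hB (center_le_slStabilizer W this)
    rwa [mul_inv_cancel_left] at h
  · intro h
    exact ⟨A, h, rfl⟩

theorem comap_pslStabilizer (W : Submodule F (Fin d → F)) :
    (pslStabilizer W).comap (QuotientGroup.mk' (Subgroup.center _)) = slStabilizer W := by
  ext A
  exact mk_mem_pslStabilizer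

/-- The hyperplane orthogonal to a vector. -/
def hyp (w : Fin d → F) : Submodule F (Fin d → F) where
  carrier := {x | w ⬝ᵥ x = 0}
  zero_mem' := dotProduct_zero w
  add_mem' := by
    intro x y hx hy
    simp only [Set.mem_ofPred_eq] at *
    rw [dotProduct_add, hx, hy, add_zero]
  smul_mem' := by
    intro c x hx
    simp only [Set.mem_ofPred_eq] at *
    rw [dotProduct_smul, hx, smul_zero]

theorem mem_hyp {w x : Fin d → F} : x ∈ hyp w ↔ w ⬝ᵥ x = 0 := Iff.rfl

theorem dual_eq_dotProduct (f : Module.Dual F (Fin d → F)) :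
    ∃ w : Fin d → F, ∀ x, f x = w ⬝ᵥ x := by
  refine ⟨fun i => f (Pi.single i 1), fun x => ?_⟩
  conv_lhs => rw [← (Pi.basisFun F (Fin d)).sum_repr x, map_sum]
  refine Finset.sum_congr rfl fun i _ => ?_
  rw [map_smul, Pi.basisFun_repr, Pi.basisFun_apply, smul_eq_mul, mul_comm]

theorem exists_dotProduct_eq_one {v : Fin d → F} (hv : v ≠ 0) : ∃ x, v ⬝ᵥ x = 1 := by
  obtain ⟨i, hi⟩ := Function.ne_iff.1 hv
  refine ⟨Pi.single i (v i)⁻¹, ?_⟩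
  rw [dotProduct_single, mul_inv_cancel₀ hi]

theorem finrank_hyp_lt {w : Fin d → F} (hw : w ≠ 0) : Module.finrank F (hyp w) < d := by
  obtain ⟨x, hx⟩ := exists_dotProduct_eq_one hw
  have hlt : hyp w < ⊤ := by
    rw [lt_top_iff_ne_top]
    intro h
    have : x ∈ hyp w := h ▸ Submodule.mem_top
    rw [mem_hyp, hx] at this
    exact one_ne_zero this
  simpa using Submodule.finrank_lt hlt.ne

theorem exists_hyp_eq {W : Submodule F (Fin d → F)} (hW : Module.finrank F W + 1 = d) :
    ∃ w : Fin d → F, w ≠ 0 ∧ W = hyp w := by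
  have hlt : W < ⊤ := by
    rw [lt_top_iff_ne_top]
    rintro rfl
    rw [finrank_top, Module.finrank_fin_fun] at hW
    omega
  obtain ⟨f, hf, hWf⟩ := W.exists_le_ker_of_lt_top hlt
  obtain ⟨w, hw⟩ := dual_eq_dotProduct f
  have hw0 : w ≠ 0 := by
    rintro rfl
    exact hf (LinearMap.ext fun x => by rw [hw, zero_dotProduct, LinearMap.zero_apply])
  refine ⟨w, hw0, Submodule.eq_of_le_of_finrank_le ?_ ?_⟩
  · intro x hx
    rw [mem_hyp, ← hw]
    exact hWf hx
  · have := finrank_hyp_lt hw0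
    omega

theorem exists_span_eq {ℓ : Submodule F (Fin d → F)} (hℓ : Module.finrank F ℓ = 1) :
    ∃ v : Fin d → F, v ≠ 0 ∧ ℓ = Submodule.span F {v} := by
  obtain ⟨v, hv, h⟩ := finrank_eq_one_iff'.1 hℓ
  refine ⟨v, fun h0 => hv (Subtype.ext h0), le_antisymm ?_ ?_⟩
  · intro x hx
    obtain ⟨c, hc⟩ := h ⟨x, hx⟩
    exact Submodule.mem_span_singleton.2 ⟨c, congrArg Subtype.val hc⟩
  · rw [Submodule.span_singleton_le_iff_mem]
    exact v.2

theorem mem_slStabilizer_span {v : Fin d → F} {A : Matrix.SpecialLinearGroup (Fin d) F} :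
    A ∈ slStabilizer (Submodule.span F {v}) ↔ ∃ c : F, A.1 *ᵥ v = c • v := by
  constructor
  · intro h
    obtain ⟨c, hc⟩ := Submodule.mem_span_singleton.1
      (mulVec_mem_of_mem_slStabilizer h (Submodule.mem_span_singleton_self v))
    exact ⟨c, hc.symm⟩
  · rintro ⟨c, hc⟩
    refine mem_slStabilizer_of_le fun x hx => ?_
    obtain ⟨a, rfl⟩ := Submodule.mem_span_singleton.1 hx
    rw [Matrix.mulVec_smul, hc]
    exact Submodule.smul_mem _ _ (Submodule.smul_mem _ _ (Submodule.mem_span_singleton_self v))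

theorem hyp_le_hyp {v w : Fin d → F} (h : hyp v ≤ hyp w) : ∃ c : F, w = c • v := by
  by_cases hv : v = 0
  · subst hv
    refine ⟨0, ?_⟩
    by_contra hw
    obtain ⟨x, hx⟩ := exists_dotProduct_eq_one (v := w) (by simpa using hw)
    have : x ∈ hyp w := h (by rw [mem_hyp, zero_dotProduct])
    rw [mem_hyp, hx] at this
    exact one_ne_zero this
  · obtain ⟨x₀, hx₀⟩ := exists_dotProduct_eq_one hv
    refine ⟨w ⬝ᵥ x₀, dotProduct_eq _ _ fun x => ?_⟩
    have : x - (v ⬝ᵥ x) • x₀ ∈ hyp w := h (by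
      rw [mem_hyp, dotProduct_sub, dotProduct_smul, hx₀, smul_eq_mul, mul_one, sub_self])
    rw [mem_hyp, dotProduct_sub, dotProduct_smul, sub_eq_zero] at this
    rw [this, smul_dotProduct, smul_eq_mul, smul_eq_mul, mul_comm]

theorem mem_slStabilizer_hyp {w : Fin d → F} {A : Matrix.SpecialLinearGroup (Fin d) F} :
    A ∈ slStabilizer (hyp w) ↔ ∃ c : F, A.1ᵀ *ᵥ w = c • w := by
  constructor
  · intro h
    apply hyp_le_hyp
    intro x hx
    rw [mem_hyp, Matrix.mulVec_transpose, ← Matrix.dotProduct_mulVec]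
    exact mulVec_mem_of_mem_slStabilizer h hx
  · rintro ⟨c, hc⟩
    refine mem_slStabilizer_of_le fun x hx => ?_
    rw [mem_hyp, Matrix.dotProduct_mulVec, ← Matrix.mulVec_transpose, hc, smul_dotProduct,
      mem_hyp.1 hx, smul_zero]

/-- The stabilizers of a subspace and of its translate are conjugate. -/
theorem map_conj_slStabilizer (W : Submodule F (Fin d → F))
    (g : Matrix.SpecialLinearGroup (Fin d) F) :
    (slStabilizer W).map (MulAut.conj g).toMonoidHom =
      slStabilizer (W.map (Matrix.SpecialLinearGroup.toLin' g).toLinearMap) := by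
  have key : ∀ (W : Submodule F (Fin d → F)) (g : Matrix.SpecialLinearGroup (Fin d) F),
      (slStabilizer W).map (MulAut.conj g).toMonoidHom ≤
      slStabilizer (W.map (Matrix.SpecialLinearGroup.toLin' g).toLinearMap) := by
    rintro W g _ ⟨A, hA, rfl⟩
    refine mem_slStabilizer_of_le ?_
    rintro _ ⟨x, hx, rfl⟩
    refine ⟨A.1 *ᵥ x, mulVec_mem_of_mem_slStabilizer hA hx, ?_⟩
    change g.1 *ᵥ (A.1 *ᵥ x) = (g * A * g⁻¹).1 *ᵥ (g.1 *ᵥ x)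
    rw [Matrix.mulVec_mulVec, Matrix.mulVec_mulVec]
    change (g * A).1 *ᵥ x = (g * A * g⁻¹ * g).1 *ᵥ x
    rw [inv_mul_cancel_right]
  refine le_antisymm (key W g) ?_
  intro B hB
  have h := key _ g⁻¹ ⟨B, hB, rfl⟩
  have hW : (W.map (Matrix.SpecialLinearGroup.toLin' g).toLinearMap).map
      (Matrix.SpecialLinearGroup.toLin' g⁻¹).toLinearMap = W := by
    rw [← Submodule.map_comp]
    have hid : (Matrix.SpecialLinearGroup.toLin' g⁻¹).toLinearMap ∘ₗ
        (Matrix.SpecialLinearGroup.toLin' g).toLinearMap = LinearMap.id := by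
      apply LinearMap.ext
      intro x
      change (Matrix.SpecialLinearGroup.toLin' g⁻¹ * Matrix.SpecialLinearGroup.toLin' g) x = x
      rw [← map_mul, inv_mul_cancel, map_one]
      rfl
    rw [hid]
    exact Submodule.map_id W
  rw [hW] at h
  refine ⟨_, h, ?_⟩
  simp [MulAut.conj_apply, mul_assoc]

theorem map_conj_pslStabilizer (W : Submodule F (Fin d → F))
    (g : Matrix.SpecialLinearGroup (Fin d) F) :
    (pslStabilizer W).map (MulAut.conj (QuotientGroup.mk' (Subgroup.center _) g)).toMonoidHom =
      pslStabilizer (W.map (Matrix.SpecialLinearGroup.toLin' g).toLinearMap) := by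
  rw [pslStabilizer, pslStabilizer, ← map_conj_slStabilizer, Subgroup.map_map, Subgroup.map_map]
  rfl

end Stabilizers

/-! ### Inverse transpose, maximality and non-conjugacy -/

section Duality

open Matrix

variable {d : ℕ} {F : Type*} [Field F]

theorem sl_transpose_mul (A B : Matrix.SpecialLinearGroup (Fin d) F) :
    (A * B).transpose = B.transpose * A.transpose :=
  Fano.sl_ext (Matrix.transpose_mul A.1 B.1)

theorem sl_transpose_transpose (A : Matrix.SpecialLinearGroup (Fin d) F) :
    A.transpose.transpose = A :=
  Fano.sl_ext (Matrix.transpose_transpose A.1)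

theorem sl_transpose_one : (1 : Matrix.SpecialLinearGroup (Fin d) F).transpose = 1 :=
  Fano.sl_ext Matrix.transpose_one

theorem sl_transpose_inv (A : Matrix.SpecialLinearGroup (Fin d) F) :
    (A⁻¹).transpose = A.transpose⁻¹ := by
  rw [eq_inv_iff_mul_eq_one, ← sl_transpose_mul, mul_inv_cancel, sl_transpose_one]

/-- The inverse-transpose automorphism of `SL_d`. -/
def invTranspose (d : ℕ) (F : Type*) [Field F] : MulAut (Matrix.SpecialLinearGroup (Fin d) F) where
  toFun A := A.transpose⁻¹
  invFun A := A.transpose⁻¹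
  left_inv A := by
    change (A.transpose⁻¹).transpose⁻¹ = A
    rw [sl_transpose_inv, inv_inv, sl_transpose_transpose]
  right_inv A := by
    change (A.transpose⁻¹).transpose⁻¹ = A
    rw [sl_transpose_inv, inv_inv, sl_transpose_transpose]
  map_mul' A B := by rw [sl_transpose_mul, _root_.mul_inv_rev]

theorem invTranspose_apply (A : Matrix.SpecialLinearGroup (Fin d) F) :
    invTranspose d F A = A.transpose⁻¹ := rfl

theorem transpose_mem_slStabilizer_hyp {w : Fin d → F} {A : Matrix.SpecialLinearGroup (Fin d) F} :
    A.transpose ∈ slStabilizer (hyp w) ↔ A ∈ slStabilizer (Submodule.span F {w}) := by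
  rw [mem_slStabilizer_hyp, mem_slStabilizer_span]
  change (∃ c : F, A.1ᵀᵀ *ᵥ w = c • w) ↔ _
  rw [Matrix.transpose_transpose]

theorem invTranspose_mem_slStabilizer_hyp {w : Fin d → F}
    {A : Matrix.SpecialLinearGroup (Fin d) F} :
    invTranspose d F A ∈ slStabilizer (hyp w) ↔ A ∈ slStabilizer (Submodule.span F {w}) := by
  rw [invTranspose_apply, inv_mem_iff, transpose_mem_slStabilizer_hyp]

/-- The automorphism of `PSL_d` induced by the inverse-transpose automorphism of `SL_d`. -/
def pslInvTranspose (d : ℕ) (F : Type*) [Field F] :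
    MulAut (Matrix.ProjectiveSpecialLinearGroup (Fin d) F) :=
  QuotientGroup.congr _ _ (invTranspose d F)
    (Subgroup.characteristic_iff_map_eq.1 inferInstance (invTranspose d F))

theorem map_pslInvTranspose (w : Fin d → F) :
    (pslStabilizer (Submodule.span F {w})).map (pslInvTranspose d F).toMonoidHom =
      pslStabilizer (hyp w) := by
  apply le_antisymm
  · rintro _ ⟨_, ⟨A, hA, rfl⟩, rfl⟩
    exact ⟨invTranspose d F A, invTranspose_mem_slStabilizer_hyp.2 hA, rfl⟩
  · rintro _ ⟨B, hB, rfl⟩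
    obtain ⟨A, rfl⟩ := (invTranspose d F).surjective B
    exact ⟨_, ⟨A, invTranspose_mem_slStabilizer_hyp.1 hB, rfl⟩, rfl⟩

/-- `SL_d` is transitive on lines. -/
theorem exists_map_span_eq {v w : Fin d → F} (hv : v ≠ 0) (hw : w ≠ 0) :
    ∃ g : Matrix.SpecialLinearGroup (Fin d) F,
      (Submodule.span F {v}).map (Matrix.SpecialLinearGroup.toLin' g).toLinearMap =
        Submodule.span F {w} := by
  obtain ⟨g, hg⟩ := MulAction.exists_smul_eq (Matrix.SpecialLinearGroup (Fin d) F)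
    (Projectivization.mk F v hv) (Projectivization.mk F w hw)
  refine ⟨g, ?_⟩
  rw [Projectivization.smul_mk, Projectivization.mk_eq_mk_iff] at hg
  obtain ⟨a, ha⟩ := hg
  rw [Submodule.map_span, Set.image_singleton]
  change Submodule.span F {g • v} = _
  rw [← ha]
  exact Submodule.span_singleton_smul_eq a.isUnit w

/-- The subgroup is a point stabilizer for the primitive action of `PSL_d` on projective space. -/
theorem isCoatom_pslStabilizer_span (hd : 2 ≤ d) {v : Fin d → F} (hv : v ≠ 0) :
    IsCoatom (pslStabilizer (Submodule.span F {v})) := by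
  have : Nontrivial (Projectivization F (Fin d → F)) := by
    have h0 : (Pi.single ⟨0, by omega⟩ 1 : Fin d → F) ≠ 0 := by simp
    have h1 : (Pi.single ⟨1, by omega⟩ 1 : Fin d → F) ≠ 0 := by simp
    refine ⟨Projectivization.mk F _ h0, Projectivization.mk F _ h1, fun h => ?_⟩
    rw [Projectivization.mk_eq_mk_iff'] at h
    obtain ⟨a, ha⟩ := h
    have := congrFun ha ⟨0, by omega⟩
    simp at this
  have h : pslStabilizer (Submodule.span F {v}) =
      MulAction.stabilizer (Matrix.ProjectiveSpecialLinearGroup (Fin d) F)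
        (Projectivization.mk F v hv) := by
    ext x
    obtain ⟨A, rfl⟩ := QuotientGroup.mk'_surjective _ x
    rw [mk_mem_pslStabilizer, mem_slStabilizer_span, MulAction.mem_stabilizer_iff]
    change _ ↔ A • Projectivization.mk F v hv = _
    rw [Projectivization.smul_mk, Projectivization.mk_eq_mk_iff']
    exact exists_congr fun c => eq_comm
  rw [h, MulAction.isCoatom_stabilizer_iff_preprimitive]
  infer_instance

theorem IsCoatom.map_mulAut {G : Type*} [Group G] {U : Subgroup G} (hU : IsCoatom U)
    (φ : MulAut G) : IsCoatom (U.map φ.toMonoidHom) :=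
  (OrderIso.isCoatom_iff φ.mapSubgroup U).2 hU

/-- For lines and hyperplanes, the stabilizers correspond under an automorphism. -/
theorem exists_mulAut_map_eq {v w : Fin d → F} (hv : v ≠ 0) (hw : w ≠ 0) :
    ∃ φ : MulAut (Matrix.ProjectiveSpecialLinearGroup (Fin d) F),
      (pslStabilizer (Submodule.span F {v})).map φ.toMonoidHom = pslStabilizer (hyp w) := by
  obtain ⟨g, hg⟩ := exists_map_span_eq hv hw
  refine ⟨(MulAut.conj (QuotientGroup.mk' _ g)).trans (pslInvTranspose d F), ?_⟩
  rw [← map_pslInvTranspose w, ← hg, ← map_conj_pslStabilizer, Subgroup.map_map]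
  rfl

theorem le_finrank_hyp_add_one (w : Fin d → F) : d ≤ Module.finrank F (hyp w) + 1 := by
  let f : (Fin d → F) →ₗ[F] F :=
    { toFun := fun x => w ⬝ᵥ x
      map_add' := dotProduct_add w
      map_smul' := fun c x => dotProduct_smul c w x }
  have hker : LinearMap.ker f = hyp w := rfl
  have h := f.finrank_range_add_finrank_ker
  rw [hker, Module.finrank_fin_fun] at h
  have h1 : Module.finrank F (LinearMap.range f) ≤ 1 := by
    simpa using Submodule.finrank_le (LinearMap.range f)
  omega

/-- As `d ≥ 3`, the hyperplane has dimension at least 2 and contains some `y` off the line of `u`.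
With a form `f` vanishing at `y` but not at `u`, the transvection `x ↦ x + f(x) y` preserves the
hyperplane and moves the line. -/
theorem not_slStabilizer_hyp_le (hd : 3 ≤ d) {u w : Fin d → F} (hu : u ≠ 0)
    (h : slStabilizer (hyp w) ≤ slStabilizer (Submodule.span F {u})) : False := by
  obtain ⟨y, hyw, hyu⟩ : ∃ y ∈ hyp w, y ∉ Submodule.span F {u} := by
    by_contra! hle
    have h1 : Module.finrank F (hyp w) ≤ 1 :=
      (Submodule.finrank_mono hle).trans (finrank_span_singleton hu).le
    have := le_finrank_hyp_add_one w
    omega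
  have huy : u ∉ Submodule.span F {y} := by
    intro hmem
    obtain ⟨c, hc⟩ := Submodule.mem_span_singleton.1 hmem
    have hc0 : c ≠ 0 := by
      rintro rfl
      exact hu (by rw [← hc, zero_smul])
    apply hyu
    refine Submodule.mem_span_singleton.2 ⟨c⁻¹, ?_⟩
    rw [← hc, smul_smul, inv_mul_cancel₀ hc0, one_smul]
  obtain ⟨φ, hφu, hφy⟩ := Submodule.exists_le_ker_of_notMem huy
  obtain ⟨f, hf⟩ := dual_eq_dotProduct φ
  have hfy : f ⬝ᵥ y = 0 := by
    rw [← hf]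
    exact hφy (Submodule.mem_span_singleton_self y)
  have hfu : f ⬝ᵥ u ≠ 0 := by rwa [← hf]
  let T : Matrix.SpecialLinearGroup (Fin d) F :=
    ⟨1 + Matrix.vecMulVec y f, by
      rw [Matrix.vecMulVec_eq Unit, Matrix.det_one_add_replicateCol_mul_replicateRow, hfy, add_zero]⟩
  have hT : T ∈ slStabilizer (hyp w) := by
    refine mem_slStabilizer_of_le fun x hx => ?_
    change (1 + Matrix.vecMulVec y f) *ᵥ x ∈ _
    rw [Matrix.add_mulVec, Matrix.one_mulVec, Matrix.vecMulVec_mulVec, op_smul_eq_smul]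
    exact add_mem hx (Submodule.smul_mem _ _ hyw)
  obtain ⟨c, hc⟩ := mem_slStabilizer_span.1 (h hT)
  change (1 + Matrix.vecMulVec y f) *ᵥ u = _ at hc
  rw [Matrix.add_mulVec, Matrix.one_mulVec, Matrix.vecMulVec_mulVec, op_smul_eq_smul] at hc
  apply hyu
  refine Submodule.mem_span_singleton.2 ⟨(f ⬝ᵥ u)⁻¹ * (c - 1), ?_⟩
  have hc' : (f ⬝ᵥ u) • y = (c - 1) • u := by
    rw [sub_smul, one_smul, ← hc]
    simp
  rw [mul_smul, ← hc', smul_smul, inv_mul_cancel₀ hfu, one_smul]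

theorem not_conjugate_span_hyp (hd : 3 ≤ d) {v w : Fin d → F} (hv : v ≠ 0) :
    ¬ SubgroupsConjugate (pslStabilizer (Submodule.span F {v})) (pslStabilizer (hyp w)) := by
  rintro ⟨x, hx⟩
  obtain ⟨g, rfl⟩ := QuotientGroup.mk'_surjective _ x
  rw [map_conj_pslStabilizer, Submodule.map_span, Set.image_singleton] at hx
  have hgv : (Matrix.SpecialLinearGroup.toLin' g).toLinearMap v ≠ 0 := by
    simpa using hv
  refine not_slStabilizer_hyp_le hd hgv (w := w) (le_of_eq ?_)
  rw [← comap_pslStabilizer, ← comap_pslStabilizer, hx]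

end Duality

/-! ### Gassmann equivalence by counting fixed lines and hyperplanes -/

section Gassmann

theorem SubgroupsConjugate.ncard_inter_eq {G : Type*} [Group G] {U V : Subgroup G}
    (h : SubgroupsConjugate U V) (C : ConjClasses G) :
    (C.carrier ∩ (U : Set G)).ncard = (C.carrier ∩ (V : Set G)).ncard := by
  obtain ⟨g, rfl⟩ := h
  refine Set.ncard_congr (fun x _ => g * x * g⁻¹) ?_ ?_ ?_
  · rintro x ⟨hxC, hxU⟩
    refine ⟨?_, x, hxU, rfl⟩
    rw [ConjClasses.mem_carrier_iff_mk_eq] at hxC ⊢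
    rw [← hxC, eq_comm, ConjClasses.mk_eq_mk_iff_isConj]
    exact isConj_iff.2 ⟨g, rfl⟩
  · intro x y _ _ h
    simpa using h
  · rintro _ ⟨hyC, x, hx, rfl⟩
    refine ⟨x, ⟨?_, hx⟩, rfl⟩
    rw [ConjClasses.mem_carrier_iff_mk_eq] at hyC ⊢
    rw [← hyC, ConjClasses.mk_eq_mk_iff_isConj]
    exact isConj_iff.2 ⟨g, rfl⟩

/-- Double counting of the pairs `(p, x)` with `x ∈ C ∩ U p`. -/
theorem sum_ncard_inter_eq {G X : Type*} [Group G] [Finite G] [Fintype X] (U : X → Subgroup G)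
    (C : Set G) : ∑ p, (C ∩ (U p : Set G)).ncard =
      ∑ x ∈ C.toFinite.toFinset, Nat.card {p // x ∈ U p} := by
  classical
  have h1 : ∀ p, (C ∩ (U p : Set G)).ncard =
      ∑ x ∈ C.toFinite.toFinset, if x ∈ U p then 1 else 0 := by
    intro p
    rw [← Finset.card_filter, ← Set.ncard_coe_finset]
    congr 1
    ext x
    simp
  have h2 : ∀ x, Nat.card {p // x ∈ U p} = ∑ p, if x ∈ U p then 1 else 0 := by
    intro x
    rw [← Finset.card_filter, Nat.card_eq_fintype_card, Fintype.card_subtype]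
  simp only [h1, h2]
  exact Finset.sum_comm

/-- Two families of conjugate subgroups are Gassmann equivalent if every group element lies in
equally many members of the two families. -/
theorem gassmannEquivalent_of_card_eq {G X : Type*} [Group G] [Finite G] [Finite X]
    (U V : X → Subgroup G) (hU : ∀ p q, SubgroupsConjugate (U p) (U q))
    (hV : ∀ p q, SubgroupsConjugate (V p) (V q))
    (h : ∀ x, Nat.card {p // x ∈ U p} = Nat.card {p // x ∈ V p}) (p q : X) :
    GassmannEquivalent (U p) (V q) := by
  have := Fintype.ofFinite X
  intro C
  have h1 := sum_ncard_inter_eq U C.carrier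
  have h2 := sum_ncard_inter_eq V C.carrier
  rw [Finset.sum_congr rfl fun r _ => (hU r p).ncard_inter_eq C, Finset.sum_const] at h1
  rw [Finset.sum_congr rfl fun r _ => (hV r q).ncard_inter_eq C, Finset.sum_const] at h2
  simp only [h] at h1
  have h3 := h1.trans h2.symm
  have hX : 0 < (Finset.univ : Finset X).card := Finset.card_pos.2 ⟨p, Finset.mem_univ p⟩
  exact Nat.eq_of_mul_eq_mul_left hX (by simpa using h3)

open Matrix

variable {d : ℕ} {F : Type*} [Field F]

theorem finrank_ker_transpose (A : Matrix (Fin d) (Fin d) F) :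
    Module.finrank F (LinearMap.ker A.mulVecLin) = Module.finrank F (LinearMap.ker Aᵀ.mulVecLin) := by
  have h1 := A.mulVecLin.finrank_range_add_finrank_ker
  have h2 := Aᵀ.mulVecLin.finrank_range_add_finrank_ker
  have h3 := Matrix.rank_transpose A
  rw [Matrix.rank, Matrix.rank] at h3
  omega

/-- The eigenvectors of a matrix, paired with their eigenvalues. -/
noncomputable def eigenEquiv (A : Matrix (Fin d) (Fin d) F) :
    (Σ c : F, {v : LinearMap.ker (A - c • (1 : Matrix (Fin d) (Fin d) F)).mulVecLin // v ≠ 0}) ≃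
      {v : Fin d → F // v ≠ 0 ∧ ∃ c : F, A *ᵥ v = c • v} := by
  refine Equiv.ofBijective (fun x => ⟨x.2.1.1, fun h => x.2.2 (Subtype.ext h), x.1, ?_⟩) ⟨?_, ?_⟩
  · have := x.2.1.2
    rw [LinearMap.mem_ker, Matrix.mulVecLin_apply, Matrix.sub_mulVec, Matrix.smul_mulVec,
      Matrix.one_mulVec, sub_eq_zero] at this
    exact this
  · rintro ⟨c, ⟨⟨v, hv⟩, hv0⟩⟩ ⟨c', ⟨⟨v', hv'⟩, hv0'⟩⟩ h
    obtain rfl : v = v' := congrArg Subtype.val h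
    have hv0'' : v ≠ 0 := fun h => hv0 (Subtype.ext h)
    rw [LinearMap.mem_ker, Matrix.mulVecLin_apply, Matrix.sub_mulVec, Matrix.smul_mulVec,
      Matrix.one_mulVec, sub_eq_zero] at hv hv'
    obtain rfl : c = c' := smul_left_injective F hv0'' (hv.symm.trans hv')
    rfl
  · rintro ⟨v, hv, c, hc⟩
    refine ⟨⟨c, ⟨⟨v, ?_⟩, fun h => hv (congrArg Subtype.val h)⟩⟩, rfl⟩
    rw [LinearMap.mem_ker, Matrix.mulVecLin_apply, Matrix.sub_mulVec, Matrix.smul_mulVec,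
      Matrix.one_mulVec, sub_eq_zero]
    exact hc

theorem card_eigenvectors_transpose (A : Matrix (Fin d) (Fin d) F) :
    Nat.card {v : Fin d → F // v ≠ 0 ∧ ∃ c : F, A *ᵥ v = c • v} =
      Nat.card {v : Fin d → F // v ≠ 0 ∧ ∃ c : F, Aᵀ *ᵥ v = c • v} := by
  rw [← Nat.card_congr (eigenEquiv A), ← Nat.card_congr (eigenEquiv Aᵀ)]
  refine Nat.card_congr (Equiv.sigmaCongrRight fun c => ?_)
  have h := finrank_ker_transpose (A - c • (1 : Matrix (Fin d) (Fin d) F))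
  rw [Matrix.transpose_sub, Matrix.transpose_smul, Matrix.transpose_one] at h
  let e := LinearEquiv.ofFinrankEq _ _ h
  exact e.toEquiv.subtypeEquiv fun v => (e.map_ne_zero_iff).symm

/-- Every line carries `|Fˣ|` non-zero vectors, so equality for eigenvectors passes to lines. -/
theorem card_eigenlines_mul (A : Matrix (Fin d) (Fin d) F) :
    Nat.card {p : Projectivization F (Fin d → F) // ∃ c : F, A *ᵥ p.rep = c • p.rep} * Nat.card Fˣ =
      Nat.card {v : Fin d → F // v ≠ 0 ∧ ∃ c : F, A *ᵥ v = c • v} := by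
  rw [← Nat.card_prod]
  refine Nat.card_congr (Equiv.ofBijective (fun x => ⟨x.2 • x.1.1.rep, ?_, ?_⟩) ⟨?_, ?_⟩)
  · exact (smul_ne_zero_iff_ne x.2).2 x.1.1.rep_nonzero
  · obtain ⟨c, hc⟩ := x.1.2
    refine ⟨c, ?_⟩
    rw [Units.smul_def, Matrix.mulVec_smul, hc, smul_comm]
  · rintro ⟨⟨p, hp⟩, a⟩ ⟨⟨q, hq⟩, b⟩ h
    have hab : a • p.rep = b • q.rep := congrArg Subtype.val h
    obtain rfl : p = q := by
      rw [← p.mk_rep, ← q.mk_rep, Projectivization.mk_eq_mk_iff]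
      refine ⟨a⁻¹ * b, ?_⟩
      rw [mul_smul, ← hab, inv_smul_smul]
    have hab' : (a : F) = b := smul_left_injective F p.rep_nonzero hab
    obtain rfl : a = b := Units.ext hab'
    rfl
  · rintro ⟨v, hv, c, hc⟩
    obtain ⟨a, ha⟩ := Projectivization.exists_smul_eq_mk_rep F v hv
    refine ⟨⟨⟨Projectivization.mk F v hv, c, ?_⟩, a⁻¹⟩, Subtype.ext ?_⟩
    · rw [← ha, Units.smul_def, Matrix.mulVec_smul, hc, smul_comm]
    · change a⁻¹ • (Projectivization.mk F v hv).rep = v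
      rw [← ha, inv_smul_smul]

theorem card_eigenlines_transpose [Finite F] (A : Matrix (Fin d) (Fin d) F) :
    Nat.card {p : Projectivization F (Fin d → F) // ∃ c : F, A *ᵥ p.rep = c • p.rep} =
      Nat.card {p : Projectivization F (Fin d → F) // ∃ c : F, Aᵀ *ᵥ p.rep = c • p.rep} := by
  have h := card_eigenvectors_transpose A
  rw [← card_eigenlines_mul, ← card_eigenlines_mul] at h
  exact Nat.eq_of_mul_eq_mul_right Nat.card_pos h

theorem subgroupsConjugate_span {v w : Fin d → F} (hv : v ≠ 0) (hw : w ≠ 0) :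
    SubgroupsConjugate (pslStabilizer (Submodule.span F {v}))
      (pslStabilizer (Submodule.span F {w})) := by
  obtain ⟨g, hg⟩ := exists_map_span_eq hv hw
  exact ⟨_, by rw [map_conj_pslStabilizer, hg]⟩

theorem subgroupsConjugate_hyp {v w : Fin d → F} (hv : v ≠ 0) (hw : w ≠ 0) :
    SubgroupsConjugate (pslStabilizer (hyp v)) (pslStabilizer (hyp w)) := by
  obtain ⟨x, hx⟩ := subgroupsConjugate_span hv hw
  refine ⟨pslInvTranspose d F x, ?_⟩
  rw [← map_pslInvTranspose, ← map_pslInvTranspose, ← hx, Subgroup.map_map, Subgroup.map_map]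
  congr 1
  ext y
  simp [MulAut.conj_apply]

theorem hyp_smul (a : Fˣ) (w : Fin d → F) : hyp (a • w) = hyp w := by
  ext x
  rw [mem_hyp, mem_hyp, smul_dotProduct]
  exact smul_eq_zero_iff_eq a

theorem gassmannEquivalent_span_hyp [Finite F] {v w : Fin d → F} (hv : v ≠ 0) (hw : w ≠ 0) :
    GassmannEquivalent (pslStabilizer (Submodule.span F {v})) (pslStabilizer (hyp w)) := by
  have key := gassmannEquivalent_of_card_eq
    (fun p : Projectivization F (Fin d → F) => pslStabilizer (Submodule.span F {p.rep}))
    (fun p : Projectivization F (Fin d → F) => pslStabilizer (hyp p.rep))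
    (fun p q => subgroupsConjugate_span p.rep_nonzero q.rep_nonzero)
    (fun p q => subgroupsConjugate_hyp p.rep_nonzero q.rep_nonzero) ?_
    (Projectivization.mk F v hv) (Projectivization.mk F w hw)
  · obtain ⟨a, ha⟩ := Projectivization.exists_smul_eq_mk_rep F v hv
    obtain ⟨b, hb⟩ := Projectivization.exists_smul_eq_mk_rep F w hw
    simp only [← ha, ← hb, hyp_smul] at key
    rwa [Units.smul_def, Submodule.span_singleton_smul_eq a.isUnit] at key
  · intro x
    obtain ⟨A, rfl⟩ := QuotientGroup.mk'_surjective _ x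
    simp only [mk_mem_pslStabilizer, mem_slStabilizer_span, mem_slStabilizer_hyp]
    exact card_eigenlines_transpose A.1

end Gassmann

/-! ### Sylow-conjugacy of the stabilizers -/

section SylowConjugate

/-- Equal orders force a conjugate of a Sylow subgroup of `U` that lies in `V` to have the full
`p`-part of `|V|`. -/
theorem exists_sylow_conj_of_le {G : Type*} [Group G] [Finite G] {U V : Subgroup G}
    (hcard : Nat.card U = Nat.card V) {p : ℕ} [Fact p.Prime] (P : Sylow p U) (g : G)
    (h : ((P : Subgroup U).map U.subtype).map (MulAut.conj g).toMonoidHom ≤ V) :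
    ∃ (P : Sylow p U) (Q : Sylow p V),
      SubgroupsConjugate ((P : Subgroup U).map U.subtype) ((Q : Subgroup V).map V.subtype) := by
  set R := ((P : Subgroup U).map U.subtype).map (MulAut.conj g).toMonoidHom with hR
  have hRc : Nat.card (R.subgroupOf V) = p ^ (Nat.card V).factorization p := by
    rw [Nat.card_congr (Subgroup.subgroupOfEquivOfLe h).toEquiv, hR,
      Nat.card_congr (Subgroup.equivMapOfInjective _ _ (MulAut.conj g).injective).symm.toEquiv,
      Nat.card_congr (Subgroup.equivMapOfInjective _ _ U.subtype_injective).symm.toEquiv,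
      ← hcard]
    exact P.card_eq_multiplicity
  refine ⟨P, Sylow.ofCard (R.subgroupOf V) hRc, g, ?_⟩
  change R = (R.subgroupOf V).map V.subtype
  rw [Subgroup.map_subgroupOf_eq_of_le h]

open Matrix

variable {d : ℕ} {F : Type*} [Field F]

/-- A group of order prime to the characteristic that fixes a line also fixes a hyperplane. -/
theorem exists_le_slStabilizer_hyp_of_card_ne_zero {v : Fin d → F} (hv : v ≠ 0)
    (P : Subgroup (Matrix.SpecialLinearGroup (Fin d) F)) [Finite P]
    (hP : P ≤ slStabilizer (Submodule.span F {v})) (hcard : (Nat.card P : F) ≠ 0) :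
    ∃ w : Fin d → F, w ≠ 0 ∧ P ≤ slStabilizer (hyp w) := by
  have := Fintype.ofFinite P
  have hex : ∀ A : P, ∃ c : F, A.1.1 *ᵥ v = c • v := fun A => mem_slStabilizer_span.1 (hP A.2)
  choose χ hχ using hex
  have hmul : ∀ A B : P, χ (A * B) = χ A * χ B := by
    intro A B
    apply smul_left_injective F hv
    change χ (A * B) • v = (χ A * χ B) • v
    rw [← hχ, mul_comm, mul_smul, ← hχ A, ← Matrix.mulVec_smul, ← hχ B, Matrix.mulVec_mulVec]
    rfl
  have hone : χ 1 = 1 := by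
    apply smul_left_injective F hv
    change χ 1 • v = (1 : F) • v
    rw [← hχ, one_smul]
    exact Matrix.one_mulVec v
  have hne : ∀ A, χ A ≠ 0 := by
    intro A h0
    have := hmul A A⁻¹
    rw [mul_inv_cancel, hone, h0, zero_mul] at this
    exact one_ne_zero this
  obtain ⟨f, hf⟩ := exists_dotProduct_eq_one hv
  -- The form `f` averaged against the character `χ` of `P` on the line: it takes the value `|P| ≠
  -- 0` at `v`, and the transposes of `P` act on it through `χ`.
  refine ⟨∑ A : P, (χ A)⁻¹ • (A.1.1ᵀ *ᵥ f), ?_, ?_⟩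
  · intro h0
    apply hcard
    have h1 : (∑ A : P, (χ A)⁻¹ • (A.1.1ᵀ *ᵥ f)) ⬝ᵥ v = Nat.card P := by
      rw [sum_dotProduct, Nat.card_eq_fintype_card, ← Finset.card_univ, Finset.cast_card]
      refine Finset.sum_congr rfl fun A _ => ?_
      rw [smul_dotProduct, Matrix.mulVec_transpose, ← Matrix.dotProduct_mulVec, hχ,
        dotProduct_smul, dotProduct_comm, hf, smul_eq_mul, smul_eq_mul, mul_one,
        inv_mul_cancel₀ (hne A)]
    rw [← h1, h0, zero_dotProduct]
  · intro B hB
    refine mem_slStabilizer_hyp.2 ⟨χ ⟨B, hB⟩, ?_⟩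
    rw [Matrix.mulVec_sum, Finset.smul_sum]
    refine Fintype.sum_equiv (Equiv.mulRight (⟨B, hB⟩ : P)) _ _ fun A => ?_
    rw [Equiv.coe_mulRight, Matrix.mulVec_smul, Matrix.mulVec_mulVec, hmul, smul_smul,
      _root_.mul_inv_rev, ← mul_assoc, mul_inv_cancel₀ (hne _), one_mul]
    congr 2
    exact (Matrix.transpose_mul _ _).symm

/-- In characteristic `p`, every `p`-group fixes a hyperplane. -/
theorem exists_le_slStabilizer_hyp_of_char [Finite F] (hd : d ≠ 0) {p : ℕ} [Fact p.Prime]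
    (hp : (p : F) = 0) (P : Subgroup (Matrix.SpecialLinearGroup (Fin d) F)) (hP : IsPGroup p P) :
    ∃ w : Fin d → F, w ≠ 0 ∧ P ≤ slStabilizer (hyp w) := by
  let Q := P.map (invTranspose d F).toMonoidHom
  have hdvd : p ∣ Nat.card (Fin d → F) := by
    have := Fintype.ofFinite F
    rw [Nat.card_fun, Nat.card_fin]
    refine dvd_pow ?_ hd
    rw [Nat.card_eq_fintype_card, ← prime_dvd_char_iff_dvd_card]
    rcases (Nat.dvd_prime Fact.out).1 ((ringChar.spec F p).1 hp) with h | h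
    · exact absurd h CharP.ringChar_ne_one
    · rw [h]
  -- The number of vectors is divisible by `p` and 0 is fixed, so the dual action fixes another
  -- vector.
  obtain ⟨w, hw, hw0⟩ := (hP.map (invTranspose d F).toMonoidHom :
      IsPGroup p Q).exists_fixed_point_of_prime_dvd_card_of_fixed_point (Fin d → F) hdvd
    (a := 0) (fun A => smul_zero A)
  refine ⟨w, hw0.symm, fun A hA => ?_⟩
  have h1 : invTranspose d F A ∈ slStabilizer (Submodule.span F {w}) :=
    mem_slStabilizer_span.2 ⟨1, by rw [one_smul]; exact hw ⟨_, A, hA, rfl⟩⟩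
  rw [← invTranspose_mem_slStabilizer_hyp] at h1
  convert h1
  exact ((invTranspose d F).left_inv A).symm

/-- The image of a Sylow subgroup is a Sylow subgroup of the image. -/
theorem exists_sylow_map {G G' : Type*} [Group G] [Group G'] [Finite G] (f : G →* G')
    (H : Subgroup G) {p : ℕ} [Fact p.Prime] (P : Sylow p H) :
    ∃ P₁ : Sylow p (H.map f), (P₁ : Subgroup (H.map f)).map (H.map f).subtype =
      ((P : Subgroup H).map H.subtype).map f := by
  have hp : IsPGroup p ((P : Subgroup H).map (f.subgroupMap H)) := P.2.map _
  have hi : ¬ p ∣ ((P : Subgroup H).map (f.subgroupMap H)).index := fun h =>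
    P.not_dvd_index (h.trans (Subgroup.index_map_dvd _ (f.subgroupMap_surjective H)))
  refine ⟨hp.toSylow hi, ?_⟩
  change ((P : Subgroup H).map (f.subgroupMap H)).map (H.map f).subtype = _
  rw [Subgroup.map_map, Subgroup.map_map]
  rfl

theorem sylowConjugate_span_hyp [Finite F] {v w : Fin d → F} (hv : v ≠ 0) (hw : w ≠ 0) :
    SylowConjugate (pslStabilizer (Submodule.span F {v})) (pslStabilizer (hyp w)) := by
  intro p hp
  have : Fact p.Prime := ⟨hp⟩
  have hd : d ≠ 0 := by
    rintro rfl
    exact hv (Subsingleton.elim _ _)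
  obtain ⟨P⟩ : Nonempty (Sylow p (slStabilizer (Submodule.span F {v}))) := inferInstance
  let P₀ : Subgroup (Matrix.SpecialLinearGroup (Fin d) F) :=
    (P : Subgroup (slStabilizer (Submodule.span F {v}))).map (Subgroup.subtype _)
  have hP₀ : P₀ ≤ slStabilizer (Submodule.span F {v}) := Subgroup.map_subtype_le _
  have hP₀p : IsPGroup p P₀ := P.2.map _
  obtain ⟨w', hw', hle⟩ : ∃ w' : Fin d → F, w' ≠ 0 ∧ P₀ ≤ slStabilizer (hyp w') := by
    by_cases hpF : (p : F) = 0
    · exact exists_le_slStabilizer_hyp_of_char hd hpF P₀ hP₀p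
    · refine exists_le_slStabilizer_hyp_of_card_ne_zero hv P₀ hP₀ ?_
      obtain ⟨n, hn⟩ := IsPGroup.iff_card.1 hP₀p
      rw [hn, Nat.cast_pow]
      exact pow_ne_zero n hpF
  obtain ⟨g, hg⟩ := subgroupsConjugate_hyp hw' hw
  obtain ⟨P₁, hP₁⟩ := exists_sylow_map (QuotientGroup.mk' (Subgroup.center _)) _ P
  refine exists_sylow_conj_of_le ?_ P₁ g ?_
  · obtain ⟨φ, hφ⟩ := exists_mulAut_map_eq hv hw
    rw [← hφ]
    exact Nat.card_congr (Subgroup.equivMapOfInjective _ _ φ.injective).toEquiv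
  · rw [← hg]
    refine Subgroup.map_mono ?_
    refine (le_of_eq hP₁).trans ?_
    rintro _ ⟨A, hA, rfl⟩
    exact mk_mem_pslStabilizer.2 (hle hA)

end SylowConjugate

/-! ### Sylow subgroups of profinite groups -/

section ProfiniteSylow

variable {H : Type*} [Group H] [TopologicalSpace H]

/-- A closed subgroup whose image in every finite quotient has index prime to `p`. -/
def HasIndexPrimeTo (p : ℕ) (S : Subgroup H) : Prop :=
  IsClosed (S : Set H) ∧ ∀ (N : Subgroup H) [N.Normal], IsOpen (N : Set H) →
    ¬ p ∣ (S.map (QuotientGroup.mk' N)).index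

variable [IsTopologicalGroup H] [CompactSpace H]

/-- In a finite quotient some member `S` of the chain has the smallest image. A coset of `N` meeting
`S` then meets every member, and by compactness it meets the intersection. -/
theorem exists_map_mk_le_map_sInf {c : Set (Subgroup H)} (hc : IsChain (· ≤ ·) c)
    (hne : c.Nonempty) (hcl : ∀ S ∈ c, IsClosed (S : Set H)) (N : Subgroup H) [N.Normal]
    (hN : IsOpen (N : Set H)) :
    ∃ S ∈ c, S.map (QuotientGroup.mk' N) ≤ (sInf c).map (QuotientGroup.mk' N) := by
  have : Finite (H ⧸ N) := Subgroup.quotient_finite_of_isOpen N hN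
  obtain ⟨S, hS, hmin⟩ := exists_minimalFor_of_wellFoundedLT (· ∈ c)
    (fun S ↦ S.map (QuotientGroup.mk' N)) hne
  refine ⟨S, hS, ?_⟩
  rintro _ ⟨x, hx, rfl⟩
  have hle : ∀ S' ∈ c, S.map (QuotientGroup.mk' N) ≤ S'.map (QuotientGroup.mk' N) := by
    intro S' hS'
    rcases hc.total hS hS' with h | h
    · exact Subgroup.map_mono h
    · exact hmin hS' (Subgroup.map_mono h)
  have hcoset : IsClosed ((x * ·) '' (N : Set H)) :=
    (Homeomorph.mulLeft x).isClosedMap _ (Subgroup.isClosed_of_isOpen N hN)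
  have : Nonempty c := hne.to_subtype
  have hdir : Directed (· ⊇ ·) fun T : c ↦ ((T : Subgroup H) : Set H) ∩ (x * ·) '' (N : Set H) := by
    intro A B
    rcases hc.total A.2 B.2 with h | h
    · exact ⟨A, subset_rfl, Set.inter_subset_inter_left _ h⟩
    · exact ⟨B, Set.inter_subset_inter_left _ h, subset_rfl⟩
  obtain ⟨y, hy⟩ := IsCompact.nonempty_iInter_of_directed_nonempty_isCompact_isClosed
    (fun T : c ↦ ((T : Subgroup H) : Set H) ∩ (x * ·) '' (N : Set H)) hdir
    (fun T ↦ by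
      obtain ⟨y, hy, hxy⟩ := hle T T.2 ⟨x, hx, rfl⟩
      exact ⟨y, hy, x⁻¹ * y, QuotientGroup.eq.1 hxy.symm, by simp⟩)
    (fun T ↦ ((hcl T T.2).inter hcoset).isCompact)
    (fun T ↦ (hcl T T.2).inter hcoset)
  rw [Set.mem_iInter] at hy
  obtain ⟨n, hn, rfl⟩ := (hy ⟨S, hS⟩).2
  refine ⟨x * n, Subgroup.mem_sInf.2 fun T hT ↦ (hy ⟨T, hT⟩).1, ?_⟩
  exact (QuotientGroup.eq.2 (by simpa using hn)).symm

theorem exists_minimal_hasIndexPrimeTo (p : ℕ) (hp : p.Prime) :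
    ∃ S : Subgroup H, HasIndexPrimeTo p S ∧ ∀ T, HasIndexPrimeTo p T → T ≤ S → S ≤ T := by
  obtain ⟨m, hm⟩ := zorn_superset
    {s : Set H | ∃ S : Subgroup H, (S : Set H) = s ∧ HasIndexPrimeTo p S} (by
      intro c hcs hc
      rcases c.eq_empty_or_nonempty with rfl | hne
      · refine ⟨_, ⟨⊤, rfl, isClosed_univ, fun N _ _ ↦ ?_⟩, by simp⟩
        rw [Subgroup.map_top_of_surjective _ (QuotientGroup.mk'_surjective N), Subgroup.index_top]
        exact hp.not_dvd_one
      let c' : Set (Subgroup H) := {S | (S : Set H) ∈ c}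
      have hp' : ∀ S ∈ c', HasIndexPrimeTo p S := by
        intro S hS
        obtain ⟨T, hT, h⟩ := hcs hS
        rwa [← SetLike.coe_injective hT]
      have hc' : IsChain (· ≤ ·) c' := by
        intro A hA B hB hAB
        exact hc hA hB (fun h ↦ hAB (SetLike.coe_injective h))
      have hne' : c'.Nonempty := by
        obtain ⟨s, hs⟩ := hne
        obtain ⟨T, rfl, -⟩ := hcs hs
        exact ⟨T, hs⟩
      refine ⟨_, ⟨sInf c', rfl, ?_, fun N _ hN hdvd ↦ ?_⟩, fun s hs ↦ ?_⟩
      · rw [Subgroup.coe_sInf]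
        exact isClosed_biInter fun S hS ↦ (hp' S hS).1
      · obtain ⟨S, hS, hle⟩ := exists_map_mk_le_map_sInf hc' hne' (fun S hS ↦ (hp' S hS).1) N hN
        exact (hp' S hS).2 N hN (hdvd.trans (Subgroup.index_dvd_of_le hle))
      · obtain ⟨T, rfl, -⟩ := hcs hs
        exact SetLike.coe_subset_coe.2 (sInf_le (show T ∈ c' from hs)))
  obtain ⟨⟨S, rfl, hS⟩, hmin⟩ := hm
  exact ⟨S, hS, fun T hT hle ↦ hmin ⟨T, rfl, hT⟩ hle⟩

/-- A minimal closed subgroup of index prime to `p` works: if its image in a finite quotient were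
not a `p`-group, the preimage of a Sylow subgroup of that image would be smaller and still of index
prime to `p`. -/
theorem exists_isProfiniteSylow (p : ℕ) (hp : p.Prime) :
    ∃ S : Subgroup H, IsProfiniteSylow p S := by
  obtain ⟨S, hS, hmin⟩ := exists_minimal_hasIndexPrimeTo (H := H) p hp
  refine ⟨S, hS.1, fun N _ hN ↦ ⟨?_, hS.2 N hN⟩⟩
  have : Fact p.Prime := ⟨hp⟩
  have : Finite (H ⧸ N) := Subgroup.quotient_finite_of_isOpen N hN
  let f := (QuotientGroup.mk' N).subgroupMap S
  have hf : Function.Surjective f := (QuotientGroup.mk' N).subgroupMap_surjective S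
  let T : Sylow p (S.map (QuotientGroup.mk' N)) := default
  let A : Subgroup S := (T : Subgroup _).comap f
  have hA : ¬ p ∣ A.index := by
    rw [Subgroup.index_comap_of_surjective _ hf]
    exact T.not_dvd_index
  have hAo : IsOpen (A : Set S) := by
    refine Subgroup.isOpen_mono (H₁ := N.subgroupOf S) ?_ (hN.preimage continuous_subtype_val)
    intro x hx
    have : f x = 1 := Subtype.ext ((QuotientGroup.eq_one_iff (x : H)).2 hx)
    change f x ∈ (T : Subgroup _)
    rw [this]
    exact one_mem _
  have hle : S ≤ A.map S.subtype := by
    refine hmin _ ⟨?_, fun N' _ hN' hdvd ↦ ?_⟩ (Subgroup.map_subtype_le A)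
    · exact hS.1.isClosedMap_subtype_val _ (Subgroup.isClosed_of_isOpen A hAo)
    · rw [Subgroup.map_map, Subgroup.index_map, MonoidHom.range_comp, Subgroup.range_subtype] at hdvd
      rcases (hp.dvd_mul).1 hdvd with h | h
      · exact hA (h.trans (Subgroup.index_dvd_of_le le_sup_left))
      · exact hS.2 N' hN' h
  have hT : (T : Subgroup (S.map (QuotientGroup.mk' N))) = ⊤ := by
    rw [eq_top_iff]
    rintro y -
    obtain ⟨x, rfl⟩ := hf y
    obtain ⟨z, hz, hzx⟩ := hle x.2
    rw [Subtype.ext hzx] at hz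
    exact hz
  have h := T.isPGroup'
  rw [hT] at h
  exact h.of_equiv Subgroup.topEquiv

end ProfiniteSylow

theorem IsProfiniteSylow.map {H A : Type*} [Group H] [TopologicalSpace H] [Group A] [TopologicalSpace A] [IsTopologicalGroup A]
    [CompactSpace A] [T2Space H] {p : ℕ} (hp : p.Prime) {T : Subgroup A}
    (hT : IsProfiniteSylow p T) (f : A →* H) (hf : Continuous f) (hind : ¬ p ∣ f.range.index) :
    IsProfiniteSylow p (T.map f) := by
  refine ⟨hf.isClosedMap _ hT.1, fun N _ hN ↦ ?_⟩
  let φ : A ⧸ N.comap f →* H ⧸ N := QuotientGroup.map (N.comap f) N f le_rfl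
  have hφ : (QuotientGroup.mk' N).comp f = φ.comp (QuotientGroup.mk' (N.comap f)) := rfl
  obtain ⟨h₁, h₂⟩ := hT.2 (N.comap f) (hN.preimage hf)
  rw [Subgroup.map_map, hφ, ← Subgroup.map_map]
  refine ⟨h₁.map φ, fun hdvd ↦ ?_⟩
  rw [Subgroup.index_map] at hdvd
  rcases hp.dvd_mul.1 hdvd with h | h
  · exact h₂ (h.trans (Subgroup.index_dvd_of_le le_sup_left))
  · refine hind (h.trans ?_)
    have : φ.range = f.range.map (QuotientGroup.mk' N) := by
      rw [← MonoidHom.range_comp, hφ, MonoidHom.range_comp, QuotientGroup.range_mk',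
        MonoidHom.range_eq_map]
    rw [this]
    exact Subgroup.index_map_dvd _ (QuotientGroup.mk'_surjective N)

/-- A Sylow subgroup `T` of the preimage of `P` is also Sylow in the preimage of `U`, the index
being `[U : P]`. A lift `γ` of the conjugating element carries the preimage of `P` onto that of `Q`,
so the conjugate of `T` by `γ` is Sylow in the preimage of `V`. -/
theorem SylowConjugate.comap {Γ G : Type*} [Group Γ] [TopologicalSpace Γ] [IsTopologicalGroup Γ]
    [CompactSpace Γ] [T2Space Γ] [Group G] [Finite G] {U V : Subgroup G} (h : SylowConjugate U V)
    (π : Γ →* G) (hπ : Function.Surjective π) (hker : IsOpen (π.ker : Set Γ)) :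
    ProfiniteSylowConjugate (U.comap π) (V.comap π) := by
  intro p hp
  have : Fact p.Prime := ⟨hp⟩
  obtain ⟨P, Q, g, hg⟩ := h p hp
  obtain ⟨γ, rfl⟩ := hπ g
  let A : Subgroup Γ := ((P : Subgroup U).map U.subtype).comap π
  have hA : IsClosed (A : Set Γ) := by
    refine Subgroup.isClosed_of_isOpen A (Subgroup.isOpen_mono (H₁ := π.ker) ?_ hker)
    intro x hx
    change π x ∈ (P : Subgroup U).map U.subtype
    rw [show π x = 1 from hx]
    exact one_mem _
  have : CompactSpace A := isCompact_iff_compactSpace.1 hA.isCompact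
  obtain ⟨T, hT⟩ := exists_isProfiniteSylow (H := A) p hp
  have hPU : (P : Subgroup U).map U.subtype ≤ U := Subgroup.map_subtype_le _
  have hQV : (Q : Subgroup V).map V.subtype ≤ V := Subgroup.map_subtype_le _
  have hmem : ∀ a : A, π (γ * a * γ⁻¹) ∈ (Q : Subgroup V).map V.subtype := by
    intro a
    rw [← hg]
    exact ⟨π a, a.2, by simp⟩
  let f₁ : A →* U.comap π := Subgroup.inclusion (Subgroup.comap_mono hPU)
  let f₂ : A →* V.comap π :=
    ((MulAut.conj γ).toMonoidHom.comp A.subtype).codRestrict _ fun a ↦ hQV (hmem a)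
  have key : ∀ (W : Subgroup G) (R : Sylow p W),
      ¬ p ∣ ((((R : Subgroup W).map W.subtype).comap π).subgroupOf (W.comap π)).index := by
    intro W R
    have : ((((R : Subgroup W).map W.subtype).comap π).subgroupOf (W.comap π)).index =
        (R : Subgroup W).index := by
      change (((R : Subgroup W).map W.subtype).comap π).relIndex (W.comap π) = _
      rw [Subgroup.relIndex_comap, Subgroup.map_comap_eq_self_of_surjective hπ]
      change (((R : Subgroup W).map W.subtype).subgroupOf W).index = _
      rw [Subgroup.subgroupOf, Subgroup.comap_map_eq_self_of_injective W.subtype_injective]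
    rw [this]
    exact R.not_dvd_index
  refine ⟨T.map f₁, T.map f₂, hT.map hp f₁ ?_ ?_, hT.map hp f₂ ?_ ?_, γ, ?_⟩
  · exact continuous_subtype_val.subtype_mk _
  · have : f₁.range = (((P : Subgroup U).map U.subtype).comap π).subgroupOf (U.comap π) :=
      Subgroup.inclusion_range _
    rw [this]
    exact key U P
  · exact ((continuous_const.mul continuous_subtype_val).mul continuous_const).subtype_mk _
  · have : f₂.range = (((Q : Subgroup V).map V.subtype).comap π).subgroupOf (V.comap π) := by
      ext x
      constructor
      · rintro ⟨a, rfl⟩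
        exact hmem a
      · intro hx
        have hx' : π x ∈ (Q : Subgroup V).map V.subtype := hx
        rw [← hg] at hx'
        obtain ⟨y, hy, hyx⟩ := hx'
        have hyx' : π γ * y * (π γ)⁻¹ = π x := hyx
        refine ⟨⟨γ⁻¹ * x * γ, ?_⟩, Subtype.ext ?_⟩
        · change π (γ⁻¹ * x * γ) ∈ (P : Subgroup U).map U.subtype
          rw [map_mul, map_mul, ← hyx', map_inv]
          rwa [show (π γ)⁻¹ * (π γ * y * (π γ)⁻¹) * π γ = y by group]
        · change γ * (γ⁻¹ * x * γ) * γ⁻¹ = x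
          group
    rw [this]
    exact key V Q
  · rw [Subgroup.map_map, Subgroup.map_map, Subgroup.map_map]
    rfl

theorem SylowConjugate.map {G G' : Type*} [Group G] [Group G'] [Finite G] {U V : Subgroup G}
    (h : SylowConjugate U V) (f : G →* G') : SylowConjugate (U.map f) (V.map f) := by
  intro p hp
  have : Fact p.Prime := ⟨hp⟩
  obtain ⟨P, Q, g, hg⟩ := h p hp
  obtain ⟨P₁, hP⟩ := exists_sylow_map f U P
  obtain ⟨Q₁, hQ⟩ := exists_sylow_map f V Q
  refine ⟨P₁, Q₁, f g, ?_⟩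
  have hf : (MulAut.conj (f g)).toMonoidHom.comp f = f.comp (MulAut.conj g).toMonoidHom := by
    ext x
    simp
  rw [hP, hQ, ← hg, Subgroup.map_map ((P : Subgroup U).map U.subtype) _ f,
    Subgroup.map_map ((P : Subgroup U).map U.subtype) f _, hf]

theorem SylowConjugate.map_conj_right {G : Type*} [Group G] [Finite G] {U V : Subgroup G}
    (h : SylowConjugate U V) (g : G) :
    SylowConjugate U (V.map (MulAut.conj g).toMonoidHom) := by
  intro p hp
  have : Fact p.Prime := ⟨hp⟩
  obtain ⟨P, Q, x, hx⟩ := h p hp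
  obtain ⟨Q₁, hQ⟩ := exists_sylow_map (MulAut.conj g).toMonoidHom V Q
  refine ⟨P, Q₁, g * x, ?_⟩
  rw [hQ, ← hx, Subgroup.map_map _ (MulAut.conj g).toMonoidHom]
  congr 1
  ext y
  simp [mul_assoc]

/-! ### From subgroups of `Gal(M/ℚ)` to absolute Galois groups -/

section Galois

variable {k M Ω : Type*} [Field k] [Field M] [Field Ω] [Algebra k M] [Algebra k Ω]

/-- The restriction of automorphisms of `Ω` along an embedding of a normal extension. -/
theorem exists_restrict_along [Normal k M] [Normal k Ω] (σ : M →ₐ[k] Ω) :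
    ∃ π : Gal(Ω/k) →* Gal(M/k), Function.Surjective π ∧ ∀ γ x, σ (π γ x) = γ (σ x) := by
  let : Algebra M Ω := σ.toRingHom.toAlgebra
  have : IsScalarTower k M Ω := IsScalarTower.of_algebraMap_eq fun x ↦ (σ.commutes x).symm
  exact ⟨AlgEquiv.restrictNormalHom M, AlgEquiv.restrictNormalHom_surjective Ω,
    fun γ x ↦ AlgEquiv.restrictNormal_commutes γ M x⟩

theorem fixingSubgroup_map_eq_comap {σ : M →ₐ[k] Ω} {π : Gal(Ω/k) →* Gal(M/k)}
    (hπ : ∀ γ x, σ (π γ x) = γ (σ x)) (K : IntermediateField k M) :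
    (K.map σ).fixingSubgroup = K.fixingSubgroup.comap π := by
  ext γ
  rw [Subgroup.mem_comap, IntermediateField.mem_fixingSubgroup_iff,
    IntermediateField.mem_fixingSubgroup_iff]
  constructor
  · intro h x hx
    exact σ.injective ((hπ γ x).trans (h (σ x) ⟨x, hx, rfl⟩))
  · rintro h _ ⟨x, hx, rfl⟩
    exact (hπ γ x).symm.trans (congrArg σ (h x hx))

/-- Two embeddings of `M` differ by some `g` in its Galois group, so both fixing subgroups are
preimages under one restriction map, the second of a conjugate by `g`. -/
theorem profiniteSylowConjugate_fixingSubgroup [FiniteDimensional k M] [IsGalois k M]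
    [IsGalois k Ω] {K L : IntermediateField k M}
    (h : SylowConjugate K.fixingSubgroup L.fixingSubgroup) (σ τ : M →ₐ[k] Ω) :
    ProfiniteSylowConjugate (K.map σ).fixingSubgroup (L.map τ).fixingSubgroup := by
  obtain ⟨π, hs, hπ⟩ := exists_restrict_along σ
  obtain ⟨g, hg⟩ : ∃ g : Gal(M/k), τ = σ.comp g.toAlgHom := by
    let : Algebra M Ω := σ.toRingHom.toAlgebra
    have : IsScalarTower k M Ω := IsScalarTower.of_algebraMap_eq fun x ↦ (σ.commutes x).symm
    exact ⟨τ.restrictNormal' M, AlgHom.ext fun x ↦ (τ.restrictNormal_commutes M x).symm⟩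
  have : T2Space Gal(Ω/k) := krullTopology_t2
  have hker : IsOpen (π.ker : Set Gal(Ω/k)) := by
    have : π.ker = ((⊤ : IntermediateField k M).map σ).fixingSubgroup := by
      rw [fixingSubgroup_map_eq_comap hπ, IntermediateField.fixingSubgroup_top]
      rfl
    rw [this]
    have : FiniteDimensional k ((⊤ : IntermediateField k M).map σ) :=
      Module.Finite.equiv (IntermediateField.equivMap ⊤ σ).toLinearEquiv
    exact IntermediateField.fixingSubgroup_isOpen _
  have hτ : (L.map τ).fixingSubgroup =
      (L.fixingSubgroup.map (MulAut.conj g).toMonoidHom).comap π := by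
    rw [hg, fixingSubgroup_map_eq_comap (π := (MulAut.conj g⁻¹).toMonoidHom.comp π)]
    · ext γ
      simp only [Subgroup.mem_comap, Subgroup.mem_map]
      constructor
      · intro h
        refine ⟨_, h, ?_⟩
        simp [mul_assoc]
      · rintro ⟨y, hy, hyx⟩
        convert hy using 1
        simp [← hyx, mul_assoc]
    · intro γ x
      change σ (g ((g⁻¹ * π γ * g⁻¹⁻¹) x)) = γ (σ (g x))
      rw [← hπ]
      congr 1
      change (g * (g⁻¹ * π γ * g⁻¹⁻¹)) x = (π γ * g) x
      congr 1
      group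
  rw [hτ, fixingSubgroup_map_eq_comap hπ]
  exact (h.map_conj_right g).comap π hs hker

/-- An isomorphism between subextensions of a normal extension is induced by an automorphism. -/
theorem subgroupsConjugate_fixingSubgroup_of_algEquiv [Normal k M] {K L : IntermediateField k M}
    (f : K ≃ₐ[k] L) : SubgroupsConjugate K.fixingSubgroup L.fixingSubgroup := by
  refine ⟨f.liftNormal M, ?_⟩
  have hf : ∀ x : K, f.liftNormal M (x : M) = (f x : M) := fun x ↦ f.liftNormal_commutes M x
  have hf' : ∀ x : L, (f.liftNormal M).symm (x : M) = (f.symm x : M) := fun x ↦ by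
    rw [AlgEquiv.symm_apply_eq, hf, f.apply_symm_apply]
  ext γ
  rw [Subgroup.mem_map, IntermediateField.mem_fixingSubgroup_iff]
  constructor
  · rintro ⟨δ, hδ, rfl⟩ x hx
    rw [IntermediateField.mem_fixingSubgroup_iff] at hδ
    change f.liftNormal M (δ ((f.liftNormal M).symm x)) = x
    rw [hf' ⟨x, hx⟩, hδ _ (f.symm ⟨x, hx⟩).2, hf, f.apply_symm_apply]
  · intro h
    refine ⟨(f.liftNormal M)⁻¹ * γ * f.liftNormal M, ?_, ?_⟩
    · rw [IntermediateField.mem_fixingSubgroup_iff]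
      intro x hx
      change (f.liftNormal M).symm (γ (f.liftNormal M x)) = x
      rw [hf ⟨x, hx⟩, h _ (f ⟨x, hx⟩).2, hf', f.symm_apply_apply]
    · change f.liftNormal M * ((f.liftNormal M)⁻¹ * γ * f.liftNormal M) * (f.liftNormal M)⁻¹ = γ
      group

end Galois

theorem NumberField.sylowConjugate_of_fixingSubgroup {M : Type*} [Field M] [NumberField M]
    [IsGalois ℚ M] {K L : IntermediateField ℚ M}
    (h : _root_.SylowConjugate K.fixingSubgroup L.fixingSubgroup) :
    NumberField.SylowConjugate K L := by
  intro σ τ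
  have hext : ∀ (E : IntermediateField ℚ M) (ρ : E →+* AlgebraicClosure ℚ),
      ∃ ρ' : M →ₐ[ℚ] AlgebraicClosure ℚ, ∀ x : E, ρ' x = ρ x := by
    intro E ρ
    let : Algebra E (AlgebraicClosure ℚ) := ρ.toAlgebra
    let f : M →ₐ[E] AlgebraicClosure ℚ := IsAlgClosed.lift
    exact ⟨f.toRingHom.toRatAlgHom, fun x ↦ f.commutes x⟩
  obtain ⟨σ', hσ⟩ := hext K σ
  obtain ⟨τ', hτ⟩ := hext L τ
  have h₁ : σ.fieldRange = K.map σ' := by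
    ext x
    constructor
    · rintro ⟨y, rfl⟩
      exact ⟨y, y.2, hσ y⟩
    · rintro ⟨y, hy, rfl⟩
      exact ⟨⟨y, hy⟩, (hσ ⟨y, hy⟩).symm⟩
  have h₂ : τ.fieldRange = L.map τ' := by
    ext x
    constructor
    · rintro ⟨y, rfl⟩
      exact ⟨y, y.2, hτ y⟩
    · rintro ⟨y, hy, rfl⟩
      exact ⟨⟨y, hy⟩, (hτ ⟨y, hy⟩).symm⟩
  rw [h₁, h₂]
  have : IsAlgClosure ℚ (AlgebraicClosure ℚ) := by
    convert! AlgebraicClosure.instIsAlgClosure ℚ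
  have h₃ : Normal ℚ (AlgebraicClosure ℚ) := IsAlgClosure.normal _ _
  have h₄ : Algebra.IsSeparable ℚ (AlgebraicClosure ℚ) := inferInstance
  have : IsGalois ℚ (AlgebraicClosure ℚ) := ⟨⟩
  exact profiniteSylowConjugate_fixingSubgroup h σ' τ'

theorem isEmpty_ringEquiv_of_not_subgroupsConjugate {M : Type*} [Field M] [CharZero M]
    [IsGalois ℚ M] {K L : IntermediateField ℚ M}
    (h : ¬ SubgroupsConjugate K.fixingSubgroup L.fixingSubgroup) : IsEmpty (K ≃+* L) :=
  ⟨fun f ↦ h (subgroupsConjugate_fixingSubgroup_of_algEquiv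
    (AlgEquiv.ofRingEquiv (f := f) fun x ↦ by simp))⟩

/-! ### A Burnside count with a twist -/

section FixedPoints

variable {G U X Y : Type*} [Group G] [Group U]

/-- For `y` over a fixed point of `Φ`, the `u` with `F y = u • y` form a coset of the stabilizer of
`y`, so each fixed orbit contributes orbit size times stabilizer size, that is `|U|`. -/
theorem card_fixedPoints_mul_card [MulAction U Y] [Finite U] {r : Y → X}
    (hs : Function.Surjective r) (hr : ∀ y y', r y = r y' ↔ ∃ u : U, u • y = y')
    (F : Y → Y) (Φ : X → X) (hF : ∀ y, r (F y) = Φ (r y)) :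
    Nat.card {x // Φ x = x} * Nat.card U = Nat.card {z : U × Y // F z.2 = z.1 • z.2} := by
  rw [← Nat.card_prod]
  obtain ⟨s, hs⟩ := hs.hasRightInverse
  have hv : ∀ y, ∃ v : U, v • s (r y) = y := fun y ↦ (hr _ _).1 (hs _)
  choose v hv using hv
  have hrs : ∀ (u : U) y, r (u • y) = r y := fun u y ↦ ((hr _ _).2 ⟨u, rfl⟩).symm
  have hw : ∀ y, Φ (r y) = r y → v (F y) • s (r y) = F y := fun y hy ↦ by
    conv_rhs => rw [← hv (F y)]
    rw [hF, hy]
  have hst : ∀ x, r (s x) = x := hs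
  exact Nat.card_congr
    -- With `s` a section and `v y` carrying the base point `s (r y)` to `y`, the factors take `y =
    -- u • s x` to `s x`, to `y`, to `s x`, and finally to `F y`.
    { toFun a := ⟨(v (F (a.2 • s a.1)) * (v (a.2 • s a.1))⁻¹ * a.2 * (v (a.2 • s a.1))⁻¹,
          a.2 • s a.1), by
        obtain ⟨⟨x, hx⟩, u⟩ := a
        have h₁ : r (u • s x) = x := by rw [hrs, hst]
        have h₂ := hv (u • s x)
        have h₃ := hw (u • s x) (by rw [h₁, hx])
        rw [h₁] at h₂ h₃
        have h₄ : (v (u • s x))⁻¹ • u • s x = s x := by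
          rw [inv_smul_eq_iff, h₂]
        simp only [mul_smul, h₄, h₃]⟩
      invFun z := (⟨r z.1.2, by
          rw [← hF, z.2, hrs]⟩, v z.1.2 * (v (F z.1.2))⁻¹ * z.1.1 * v z.1.2)
      left_inv := by
        rintro ⟨⟨x, hx⟩, u⟩
        have h₁ : r (u • s x) = x := by rw [hrs, hst]
        refine Prod.ext (Subtype.ext h₁) ?_
        dsimp only
        group
      right_inv := by
        rintro ⟨⟨u, y⟩, h⟩
        dsimp only at h
        have h₁ : Φ (r y) = r y := by rw [← hF, h, hrs]
        have h₂ : (v y * (v (F y))⁻¹ * u * v y) • s (r y) = y := by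
          rw [mul_smul, hv, mul_smul, ← h, mul_smul]
          nth_rewrite 2 [← hw y h₁]
          rw [inv_smul_smul, hv]
        refine Subtype.ext (Prod.ext ?_ h₂)
        dsimp only
        rw [h₂]
        group }

/-- A class function can be summed one conjugacy class at a time, and the classes meet `U` and `V`
equally often. -/
theorem GassmannEquivalent.sum_eq [Finite G] {U V : Subgroup G} (h : GassmannEquivalent U V)
    (c : G → ℕ) (hc : ∀ g x, c (g * x * g⁻¹) = c x) [Fintype U] [Fintype V] :
    ∑ u : U, c u = ∑ v : V, c v := by
  classical
  have := Fintype.ofFinite G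
  let c' : ConjClasses G → ℕ := Quotient.lift c fun a b hab ↦ by
    obtain ⟨g, hg⟩ := isConj_iff.1 hab
    rw [← hg, hc]
  have key : ∀ (W : Subgroup G) [Fintype W], ∑ w : W, c w =
      ∑ C : ConjClasses G, (C.carrier ∩ (W : Set G)).ncard * c' C := by
    intro W _
    rw [← Finset.sum_fiberwise (s := Finset.univ) (g := fun w : W ↦ ConjClasses.mk (w : G))]
    refine Finset.sum_congr rfl fun C _ ↦ ?_
    rw [Finset.sum_congr rfl (g := fun _ ↦ c' C), Finset.sum_const, smul_eq_mul]
    · congr 1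
      rw [← Set.ncard_coe_finset, ← Set.ncard_image_of_injective _ Subtype.val_injective]
      congr 1
      ext g
      simp [ConjClasses.mem_carrier_iff_mk_eq, and_comm]
    · intro w hw
      rw [← (Finset.mem_filter.1 hw).2]
      rfl
  rw [key, key]
  exact Finset.sum_congr rfl fun C _ ↦ by rw [h C]

theorem GassmannEquivalent.card_eq [Finite G] {U V : Subgroup G} (h : GassmannEquivalent U V) :
    Nat.card U = Nat.card V := by
  have := Fintype.ofFinite U
  have := Fintype.ofFinite V
  simpa [Nat.card_eq_fintype_card] using h.sum_eq (fun _ ↦ 1) fun _ _ ↦ rfl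

/-- Gassmann equivalent subgroups `U` and `V` of a group `G` acting on `Y` produce the same number
of fixed points of a `G`-equivariant map on the sets of orbits `X = Y/U` and `X' = Y/V`. -/
theorem GassmannEquivalent.card_fixedPoints_eq [Finite G] {U V : Subgroup G}
    (h : GassmannEquivalent U V) [MulAction G Y] [Finite Y] {X' : Type*} {r : Y → X} {r' : Y → X'}
    (hs : Function.Surjective r) (hs' : Function.Surjective r')
    (hr : ∀ y y', r y = r y' ↔ ∃ u : U, u • y = y')
    (hr' : ∀ y y', r' y = r' y' ↔ ∃ v : V, v • y = y')
    (F : Y → Y) (hFG : ∀ (g : G) y, F (g • y) = g • F y) (Φ : X → X) (Φ' : X' → X')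
    (hF : ∀ y, r (F y) = Φ (r y)) (hF' : ∀ y, r' (F y) = Φ' (r' y)) :
    Nat.card {x // Φ x = x} = Nat.card {x // Φ' x = x} := by
  have := Fintype.ofFinite U
  have := Fintype.ofFinite V
  have key : ∀ (W : Subgroup G) [Fintype W], Nat.card {z : W × Y // F z.2 = z.1 • z.2} =
      ∑ w : W, Nat.card {y // F y = (w : G) • y} := by
    intro W _
    rw [← Nat.card_sigma]
    exact Nat.card_congr
      { toFun := fun z ↦ ⟨z.1.1, z.1.2, z.2⟩
        invFun := fun z ↦ ⟨(z.1, z.2.1), z.2.2⟩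
        left_inv := fun _ ↦ rfl
        right_inv := fun _ ↦ rfl }
  have h₁ := card_fixedPoints_mul_card hs hr F Φ hF
  have h₂ := card_fixedPoints_mul_card hs' hr' F Φ' hF'
  rw [key] at h₁ h₂
  rw [h.sum_eq (fun g ↦ Nat.card {y // F y = g • y}) ?_, ← h₂, h.card_eq] at h₁
  · exact Nat.eq_of_mul_eq_mul_right Nat.card_pos h₁
  -- The count of `y` with `F y = g • y` is a class function because `F` commutes with the action.
  · intro g x
    refine Nat.card_congr ((MulAction.toPerm g⁻¹).subtypeEquiv fun y ↦ ?_)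
    rw [MulAction.toPerm_apply, hFG, inv_smul_eq_iff, smul_smul, smul_smul]

end FixedPoints

/-! ### Homomorphisms from rings of integers as orbits -/

section RingHomOrbits

open Polynomial in
/-- Two homomorphisms to a domain that agree on the invariants of a finite group differ by an
element of this group. -/
theorem exists_forall_apply_eq_apply_smul (A : Type*) {B G Ω : Type*} [CommRing A] [CommRing B]
    [Algebra A B] [Group G] [Finite G] [MulSemiringAction G B] [Algebra.IsInvariant A B G]
    [CommRing Ω] [IsDomain Ω] [Module.Finite ℤ B] (y y' : B →+* Ω)
    (h : ∀ a : A, y (algebraMap A B a) = y' (algebraMap A B a)) :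
    ∃ g : G, ∀ b, y' b = y (g • b) := by
  classical
  have := Fintype.ofFinite G
  obtain ⟨n, s, hs⟩ := Module.Finite.exists_fin (R := ℤ) (M := B)
  -- All generators of `B` are packed as coefficients of one polynomial, so that a single `g` will
  -- serve them all.
  let b : B[X] := Polynomial.ofFn n s
  have hb : ∀ i : Fin n, b.coeff i = s i := fun i ↦ Polynomial.ofFn_coeff_eq_val_of_lt s i.2
  have hmap : (MulSemiringAction.charpoly G b).map (mapRingHom y') =
      (MulSemiringAction.charpoly G b).map (mapRingHom y) := by
    refine Polynomial.ext fun i ↦ Polynomial.ext fun j ↦ ?_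
    rw [coeff_map, coeff_map, coe_mapRingHom, coe_mapRingHom, coeff_map, coeff_map]
    obtain ⟨a, ha⟩ := Algebra.IsInvariant.isInvariant (A := A) (G := G)
      (((MulSemiringAction.charpoly G b).coeff i).coeff j) (fun g ↦ by
        conv_rhs => rw [← MulSemiringAction.smul_coeff_charpoly b i g]
        rfl)
    rw [← ha, h]
  have hroot : eval (mapRingHom y' b) ((MulSemiringAction.charpoly G b).map (mapRingHom y)) = 0 := by
    rw [← hmap, eval_map, eval₂_hom, MulSemiringAction.eval_charpoly, map_zero]
  rw [MulSemiringAction.charpoly_eq, Polynomial.map_prod, eval_prod, Finset.prod_eq_zero_iff]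
    at hroot
  -- The polynomial `∏ (X - g • b)` has invariant coefficients, so `y' b` is a root of its image
  -- under `y`; in a domain some factor vanishes.
  obtain ⟨g, -, hg⟩ := hroot
  rw [Polynomial.map_sub, map_X, map_C, eval_sub, eval_X, eval_C, sub_eq_zero] at hg
  refine ⟨g, fun x ↦ ?_⟩
  have hx : x ∈ Submodule.span ℤ (Set.range s) := hs ▸ Submodule.mem_top
  induction hx using Submodule.span_induction with
  | mem x hx =>
    obtain ⟨i, rfl⟩ := hx
    have := congrArg (fun q ↦ q.coeff (i : ℕ)) hg
    simp only [coe_mapRingHom, coeff_map] at this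
    rw [hb] at this
    rw [this, ← hb]
    rfl
  | zero => simp
  | add x z _ _ hx hz => rw [map_add, hx, hz, smul_add, map_add]
  | smul a x _ hx => rw [map_zsmul, hx, smul_comm, map_zsmul]

/-- The action of a group on the homomorphisms out of a ring on which it acts. -/
@[reducible]
def ringHomMulAction (G B Ω : Type*) [Group G] [Semiring B] [Semiring Ω] [MulSemiringAction G B] :
    MulAction G (B →+* Ω) where
  smul g y := y.comp (MulSemiringAction.toRingHom G B g⁻¹)
  one_smul y := by
    ext x
    change y ((1 : G)⁻¹ • x) = y x
    rw [inv_one, one_smul]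
  mul_smul g h y := by
    ext x
    change y ((g * h)⁻¹ • x) = y (h⁻¹ • g⁻¹ • x)
    rw [_root_.mul_inv_rev, mul_smul]

/-- Lying over provides a prime `Q` above the kernel of `f`; then `B ⧸ Q` is integral over `A ⧸ ker
f` and embeds in the algebraically closed `Ω`. -/
theorem exists_ringHom_extension {A B Ω : Type*} [CommRing A] [CommRing B] [Algebra A B]
    [Algebra.IsIntegral A B] [Field Ω] [IsAlgClosed Ω]
    (hinj : Function.Injective (algebraMap A B)) (f : A →+* Ω) :
    ∃ y : B →+* Ω, ∀ a, y (algebraMap A B a) = f a := by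
  have : (RingHom.ker f).IsPrime := RingHom.ker_isPrime f
  obtain ⟨Q, -, hQ, hQf⟩ := Ideal.exists_ideal_over_prime_of_isIntegral (RingHom.ker f)
    (⊥ : Ideal B) (by
      rw [← RingHom.ker_eq_comap_bot, (RingHom.injective_iff_ker_eq_bot _).1 hinj]
      exact bot_le)
  have : Q.LiesOver (RingHom.ker f) := ⟨hQf.symm⟩
  let f' : A ⧸ RingHom.ker f →+* Ω := RingHom.kerLift f
  have hf' : Function.Injective f' := RingHom.kerLift_injective f
  let : Algebra (A ⧸ RingHom.ker f) Ω := f'.toAlgebra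
  have : FaithfulSMul (A ⧸ RingHom.ker f) Ω := (faithfulSMul_iff_algebraMap_injective _ _).2 hf'
  have : Module.IsTorsionFree (A ⧸ RingHom.ker f) Ω := inferInstance
  have : Module.IsTorsionFree (A ⧸ RingHom.ker f) (B ⧸ Q) :=
    Module.isTorsionFree_iff_faithfulSMul.2 (Ideal.Quotient.instFaithfulSMul _ _)
  let y : B ⧸ Q →ₐ[A ⧸ RingHom.ker f] Ω := IsAlgClosed.lift
  refine ⟨(y : B ⧸ Q →+* Ω).comp (Ideal.Quotient.mk Q), fun a ↦ ?_⟩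
  exact y.commutes (Ideal.Quotient.mk (RingHom.ker f) a)

end RingHomOrbits

instance IntermediateField.isInvariant_fixingSubgroup {M : Type*} [Field M] [NumberField M]
    [IsGalois ℚ M] (K : IntermediateField ℚ M) :
    Algebra.IsInvariant (𝓞 K) (𝓞 M) K.fixingSubgroup where
  isInvariant x hx := by
    have hxK : (x : M) ∈ K := by
      rw [← IsGalois.fixedField_fixingSubgroup K, IntermediateField.mem_fixedField_iff]
      exact fun g hg ↦ congrArg (algebraMap (𝓞 M) M) (hx ⟨g, hg⟩)
    have hxi : IsIntegral ℤ (⟨x, hxK⟩ : K) :=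
      (isIntegral_algHom_iff (K.val.restrictScalars ℤ) K.val.injective).1 x.isIntegral_coe
    exact ⟨⟨⟨x, hxK⟩, hxi⟩, rfl⟩

instance NumberField.finite_ringHom_ringOfIntegers {M Ω : Type*} [Field M] [NumberField M]
    [IsGalois ℚ M] [CommRing Ω] [IsDomain Ω] : Finite (𝓞 M →+* Ω) := by
  have : Algebra.IsInvariant ℤ (𝓞 M) Gal(M/ℚ) := inferInstance
  rcases isEmpty_or_nonempty (𝓞 M →+* Ω) with h | ⟨⟨y⟩⟩
  · infer_instance
  · refine Finite.of_surjective (fun g : Gal(M/ℚ) ↦ y.comp (MulSemiringAction.toRingHom _ _ g))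
      fun y' ↦ ?_
    obtain ⟨g, hg⟩ := exists_forall_apply_eq_apply_smul (G := Gal(M/ℚ)) ℤ y y' (fun a ↦ by simp)
    exact ⟨g, RingHom.ext fun b ↦ (hg b).symm⟩

/-- Restriction from `𝓞 M` is surjective with the orbits of the fixing subgroup as fibres, and
composition with `φ` commutes with the Galois action. -/
theorem GassmannEquivalent.card_ringHom_eq {M Ω : Type*} [Field M] [NumberField M] [IsGalois ℚ M]
    {K L : IntermediateField ℚ M} (h : GassmannEquivalent K.fixingSubgroup L.fixingSubgroup)
    [Field Ω] [IsAlgClosed Ω] (φ : Ω →+* Ω) :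
    Nat.card {f : 𝓞 K →+* Ω // φ.comp f = f} = Nat.card {f : 𝓞 L →+* Ω // φ.comp f = f} := by
  let : MulAction Gal(M/ℚ) (𝓞 M →+* Ω) := ringHomMulAction _ _ _
  have hs : ∀ E : IntermediateField ℚ M, Function.Surjective
      fun y : 𝓞 M →+* Ω ↦ y.comp (algebraMap (𝓞 E) (𝓞 M)) := by
    intro E f
    obtain ⟨y, hy⟩ := exists_ringHom_extension (B := 𝓞 M)
      (FaithfulSMul.algebraMap_injective (𝓞 E) (𝓞 M)) f
    exact ⟨y, RingHom.ext hy⟩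
  have hr : ∀ (E : IntermediateField ℚ M) (y y' : 𝓞 M →+* Ω),
      y.comp (algebraMap (𝓞 E) (𝓞 M)) = y'.comp (algebraMap (𝓞 E) (𝓞 M)) ↔
        ∃ u : E.fixingSubgroup, u • y = y' := by
    intro E y y'
    constructor
    · intro hyy
      obtain ⟨g, hg⟩ := exists_forall_apply_eq_apply_smul (G := E.fixingSubgroup) (𝓞 E) y y'
        (RingHom.congr_fun hyy)
      refine ⟨g⁻¹, RingHom.ext fun b ↦ ?_⟩
      change y ((g⁻¹ : E.fixingSubgroup)⁻¹ • b) = y' b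
      rw [inv_inv, hg]
    · rintro ⟨u, rfl⟩
      refine RingHom.ext fun a ↦ ?_
      change y _ = y (u⁻¹ • _)
      congr 1
      exact (NumberField.RingOfIntegers.ext ((IntermediateField.mem_fixingSubgroup_iff _ _).1
        u⁻¹.2 _ (a : E).2)).symm
  exact h.card_fixedPoints_eq (hs K) (hs L) (hr K) (hr L) (fun y ↦ φ.comp y) (fun _ _ ↦ rfl)
    (fun f ↦ φ.comp f) (fun f ↦ φ.comp f) (fun _ ↦ rfl) (fun _ ↦ rfl)

/-! ### Counting primes by homomorphisms fixed by Frobenius -/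

section PrimeCounting

variable {R : Type*} [CommRing R] [IsDedekindDomain R] [Module.Free ℤ R]

/-- The prime ideals of norm `q`. -/
abbrev PrimesOfNorm (R : Type*) [CommRing R] [IsDedekindDomain R] [Module.Free ℤ R] (q : ℕ) :
    Type _ :=
  {P : Ideal R // P.IsPrime ∧ Ideal.absNorm P = q}

theorem Ideal.absNorm_eq_natCard_quotient (P : Ideal R) : Ideal.absNorm P = Nat.card (R ⧸ P) := rfl

theorem isEmpty_primesOfNorm_one : IsEmpty (PrimesOfNorm R 1) :=
  ⟨fun P ↦ P.2.1.ne_top (Ideal.absNorm_eq_one_iff.1 P.2.2)⟩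

instance finite_primesOfNorm [Module.Finite ℤ R] [CharZero R] (q : ℕ) : Finite (PrimesOfNorm R q) :=
  ((Ideal.finite_setOfPred_absNorm_eq (S := R) q).subset fun _ hP ↦ hP.2).to_subtype

variable {Ω : Type*} [Field Ω]

theorem Ideal.absNorm_ker_ne_zero [Module.Finite ℤ R] [CharZero R] (p : ℕ) [Fact p.Prime] [CharP Ω p] (f : R →+* Ω) :
    Ideal.absNorm (RingHom.ker f) ≠ 0 := by
  rw [Ne, Ideal.absNorm_eq_zero_iff]
  intro h
  have hp : (p : R) ∈ RingHom.ker f := by rw [RingHom.mem_ker, map_natCast, CharP.cast_eq_zero]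
  rw [h, Ideal.mem_bot, Nat.cast_eq_zero] at hp
  exact (Fact.out : p.Prime).ne_zero hp

variable (p : ℕ) [Fact p.Prime] [CharP Ω p]

/-- The residue field embeds in `Ω` and consists of roots of `X ^ (p ^ n) - X`, so it has at most `p
^ n` elements. -/
theorem Ideal.exists_absNorm_ker_eq_pow [Module.Finite ℤ R] [CharZero R] (f : R →+* Ω) {n : ℕ} (hn : n ≠ 0)
    (hf : (iterateFrobenius Ω p n).comp f = f) :
    ∃ j ∈ Finset.range (n + 1), Ideal.absNorm (RingHom.ker f) = p ^ j := by
  classical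
  have h0 := Ideal.absNorm_ker_ne_zero p f
  rw [Ideal.absNorm_eq_natCard_quotient] at h0 ⊢
  have hp : p.Prime := Fact.out
  have hfin : Finite (R ⧸ RingHom.ker f) := Nat.finite_of_card_ne_zero h0
  have hprime : (RingHom.ker f).IsPrime := RingHom.ker_isPrime f
  have : Fintype (R ⧸ RingHom.ker f) := Fintype.ofFinite _
  let := Fintype.fieldOfDomain (R ⧸ RingHom.ker f)
  let g : R ⧸ RingHom.ker f →+* Ω := RingHom.kerLift f
  have hg : Function.Injective g := RingHom.kerLift_injective f
  have : CharP (R ⧸ RingHom.ker f) p := (RingHom.charP_iff g hg p).2 inferInstance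
  obtain ⟨j, -, hj⟩ := FiniteField.card (R ⧸ RingHom.ker f) p
  rw [Nat.card_eq_fintype_card]
  refine ⟨j, ?_, hj⟩
  rw [Finset.mem_range, Nat.lt_succ_iff]
  refine (Nat.pow_le_pow_iff_right hp.one_lt).1 ?_
  rw [← hj, ← FiniteField.X_pow_card_pow_sub_X_natDegree_eq (R ⧸ RingHom.ker f) hn hp.one_lt]
  refine Polynomial.card_le_degree_of_subset_roots (Z := Finset.univ) fun x _ ↦ ?_
  rw [Polynomial.mem_roots (FiniteField.X_pow_card_pow_sub_X_ne_zero _ hn hp.one_lt)]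
  have hx : g (x ^ p ^ n) = g x := by
    obtain ⟨x, rfl⟩ := Ideal.Quotient.mk_surjective x
    rw [map_pow]
    exact RingHom.congr_fun hf x
  simp [hg hx]

/-- A homomorphism amounts to its kernel together with an embedding of the residue field. -/
theorem card_ringHom_absNorm_ker_eq (n j : ℕ) :
    Nat.card {f : R →+* Ω // (iterateFrobenius Ω p n).comp f = f ∧
        Ideal.absNorm (RingHom.ker f) = p ^ j} =
      Nat.card (PrimesOfNorm R (p ^ j)) *
        Nat.card {g : GaloisField p j →+* Ω // (iterateFrobenius Ω p n).comp g = g} := by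
  classical
  -- For `j = 0` no field has `p ^ 0` elements; both sides vanish because no prime has norm 1.
  rcases Nat.eq_zero_or_pos j with rfl | hj
  · rw [pow_zero]
    have := isEmpty_primesOfNorm_one (R := R)
    have : IsEmpty {f : R →+* Ω // (iterateFrobenius Ω p n).comp f = f ∧
        Ideal.absNorm (RingHom.ker f) = 1} :=
      ⟨fun f ↦ this.false ⟨_, RingHom.ker_isPrime f.1, f.2.2⟩⟩
    rw [Nat.card_of_isEmpty, Nat.card_of_isEmpty, zero_mul]
  have hp : p.Prime := Fact.out
  have he : ∀ P : PrimesOfNorm R (p ^ j), Nonempty (R ⧸ P.1 ≃+* GaloisField p j) := by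
    rintro ⟨P, hP, hN⟩
    rw [Ideal.absNorm_eq_natCard_quotient] at hN
    have : Finite (R ⧸ P) := Nat.finite_of_card_ne_zero (by rw [hN]; exact pow_ne_zero _ hp.ne_zero)
    have : Fintype (R ⧸ P) := Fintype.ofFinite _
    have : Fintype (GaloisField p j) := Fintype.ofFinite _
    let := Fintype.fieldOfDomain (R ⧸ P)
    refine ⟨FiniteField.ringEquivOfCardEq ?_⟩
    rw [← Nat.card_eq_fintype_card, ← Nat.card_eq_fintype_card, hN, GaloisField.card p j hj.ne']
  let e := fun P ↦ (he P).some
  let ψ : ∀ P : PrimesOfNorm R (p ^ j), (GaloisField p j →+* Ω) → R →+* Ω := fun P g ↦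
    (g.comp (e P : R ⧸ P.1 →+* GaloisField p j)).comp (Ideal.Quotient.mk P.1)
  have hψ : ∀ P g x, ψ P g x = g (e P (Ideal.Quotient.mk P.1 x)) := fun _ _ _ ↦ rfl
  have hker : ∀ P g, RingHom.ker (ψ P g) = P.1 := by
    intro P g
    ext x
    rw [RingHom.mem_ker, hψ, map_eq_zero, map_eq_zero_iff _ (e P).injective,
      Ideal.Quotient.eq_zero_iff_mem]
  rw [← Nat.card_prod]
  refine (Nat.card_congr (Equiv.ofBijective (fun a ↦ ⟨ψ a.1 a.2.1,
    RingHom.ext fun x ↦ RingHom.congr_fun a.2.2 _, by rw [hker, a.1.2.2]⟩) ⟨?_, ?_⟩)).symm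
  · rintro ⟨P, g, hg⟩ ⟨P', g', hg'⟩ h
    have h' : ψ P g = ψ P' g' := congrArg Subtype.val h
    obtain rfl : P = P' := Subtype.ext (by rw [← hker P g, h', hker])
    have : g = g' := RingHom.ext fun y ↦ by
      obtain ⟨z, rfl⟩ := (e P).surjective y
      obtain ⟨x, rfl⟩ := Ideal.Quotient.mk_surjective z
      exact RingHom.congr_fun h' x
    subst this
    rfl
  · rintro ⟨f, hf, hN⟩
    let P : PrimesOfNorm R (p ^ j) := ⟨RingHom.ker f, RingHom.ker_isPrime f, hN⟩
    let g : GaloisField p j →+* Ω := (RingHom.kerLift f).comp (e P).symm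
    have hgf : ψ P g = f := RingHom.ext fun x ↦ by
      rw [hψ]
      change RingHom.kerLift f ((e P).symm (e P (Ideal.Quotient.mk P.1 x))) = f x
      rw [RingEquiv.symm_apply_apply]
      rfl
    refine ⟨(P, ⟨g, RingHom.ext fun y ↦ ?_⟩), Subtype.ext hgf⟩
    obtain ⟨z, rfl⟩ := (e P).surjective y
    obtain ⟨x, rfl⟩ := Ideal.Quotient.mk_surjective z
    change iterateFrobenius Ω p n (ψ P g x) = ψ P g x
    rw [hgf]
    exact RingHom.congr_fun hf x

theorem card_ringHom_eq_sum [Module.Finite ℤ R] [CharZero R] [Finite (R →+* Ω)] {n : ℕ} (hn : n ≠ 0) :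
    Nat.card {f : R →+* Ω // (iterateFrobenius Ω p n).comp f = f} =
      ∑ j ∈ Finset.range (n + 1), Nat.card (PrimesOfNorm R (p ^ j)) *
        Nat.card {g : GaloisField p j →+* Ω // (iterateFrobenius Ω p n).comp g = g} := by
  classical
  have := Fintype.ofFinite (R →+* Ω)
  have hp : p.Prime := Fact.out
  simp_rw [← card_ringHom_absNorm_ker_eq]
  rw [Nat.card_eq_fintype_card, Fintype.card_subtype, Finset.card_eq_sum_card_fiberwise
    (f := fun f ↦ Ideal.absNorm (RingHom.ker f)) (t := (Finset.range (n + 1)).image (p ^ ·)),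
    Finset.sum_image fun _ _ _ _ h ↦ Nat.pow_right_injective hp.two_le h]
  · refine Finset.sum_congr rfl fun j _ ↦ ?_
    rw [Nat.card_eq_fintype_card, Fintype.card_subtype, Finset.filter_filter]
  · intro f hf
    obtain ⟨j, hj, h⟩ := Ideal.exists_absNorm_ker_eq_pow p f hn (Finset.mem_filter.1 hf).2
    exact Finset.mem_coe.2 (Finset.mem_image.2 ⟨j, hj, h.symm⟩)

theorem nonempty_galoisField_ringHom [IsAlgClosed Ω] {n : ℕ} (hn : n ≠ 0) :
    Nonempty {g : GaloisField p n →+* Ω // (iterateFrobenius Ω p n).comp g = g} := by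
  let := ZMod.algebra Ω p
  let g : GaloisField p n →ₐ[ZMod p] Ω := IsAlgClosed.lift
  refine ⟨g, RingHom.ext fun x ↦ ?_⟩
  have := Fintype.ofFinite (GaloisField p n)
  have hx : x ^ p ^ n = x := by
    rw [← GaloisField.card p n hn, Nat.card_eq_fintype_card, FiniteField.pow_card]
  change iterateFrobenius Ω p n (g x) = g x
  rw [iterateFrobenius_def, ← map_pow, hx]

/-- The system expressing homomorphism counts by prime counts is triangular, and its diagonal
coefficient, the number of embeddings of the field with `p ^ n` elements, is positive. -/
theorem card_primesOfNorm_pow_eq [IsAlgClosed Ω] [Module.Finite ℤ R] [CharZero R] [Finite (R →+* Ω)] {S : Type*}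
    [CommRing S] [IsDedekindDomain S] [Module.Free ℤ S] [Module.Finite ℤ S] [CharZero S]
    [Finite (S →+* Ω)]
    (h : ∀ n, Nat.card {f : R →+* Ω // (iterateFrobenius Ω p n).comp f = f} =
      Nat.card {f : S →+* Ω // (iterateFrobenius Ω p n).comp f = f}) (n : ℕ) :
    Nat.card (PrimesOfNorm R (p ^ n)) = Nat.card (PrimesOfNorm S (p ^ n)) := by
  induction n using Nat.strong_induction_on with
  | _ n ih =>
    rcases Nat.eq_zero_or_pos n with rfl | hn
    · rw [pow_zero]
      have := isEmpty_primesOfNorm_one (R := R)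
      have := isEmpty_primesOfNorm_one (R := S)
      rw [Nat.card_of_isEmpty, Nat.card_of_isEmpty]
    · have hn' := h n
      rw [card_ringHom_eq_sum p hn.ne', card_ringHom_eq_sum p hn.ne', Finset.sum_range_succ, Finset.sum_range_succ,
        Finset.sum_congr rfl fun j hj ↦ by rw [ih j (Finset.mem_range.1 hj)]] at hn'
      have := nonempty_galoisField_ringHom p (Ω := Ω) hn.ne'
      have : Finite (GaloisField p n →+* Ω) := by
        let := ZMod.algebra Ω p
        refine Finite.of_injective (β := GaloisField p n →ₐ[ZMod p] Ω)
          (fun g ↦ { g with commutes' := RingHom.congr_fun (Subsingleton.elim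
            (g.comp (algebraMap (ZMod p) _)) (algebraMap (ZMod p) Ω)) }) fun g g' hgg ↦ ?_
        exact RingHom.ext fun x ↦ DFunLike.congr_fun hgg x
      exact Nat.eq_of_mul_eq_mul_right Nat.card_pos (Nat.add_left_cancel hn')

end PrimeCounting

/-! ### From primes to ideals and zeta functions -/

section IdealCounting

variable (R : Type*) [CommRing R] [IsDedekindDomain R]

/-- The nonzero ideals of a Dedekind domain correspond to the multisets of nonzero primes. -/
noncomputable def nonzeroIdealEquivMultiset :
    {I : Ideal R // I ≠ 0} ≃ Multiset {P : Ideal R // Prime P} where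
  toFun I := (UniqueFactorizationMonoid.normalizedFactors I.1).attach.map fun P ↦
    ⟨P.1, UniqueFactorizationMonoid.prime_of_normalized_factor P.1 P.2⟩
  invFun s := ⟨(s.map Subtype.val).prod, by
    rw [Ne, Multiset.prod_eq_zero_iff, Multiset.mem_map]
    rintro ⟨P, -, hP⟩
    exact P.2.ne_zero hP⟩
  left_inv I := Subtype.ext <| by
    dsimp only
    rw [Multiset.map_map]
    simp only [Function.comp_def, Multiset.attach_map_val]
    exact associated_iff_eq.1 (UniqueFactorizationMonoid.prod_normalizedFactors I.2)
  right_inv s := by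
    refine Multiset.map_injective Subtype.val_injective ?_
    dsimp only
    rw [Multiset.map_map]
    simp only [Function.comp_def, Multiset.attach_map_val]
    refine UniqueFactorizationMonoid.normalizedFactors_prod_of_prime fun P hP ↦ ?_
    obtain ⟨P, -, rfl⟩ := Multiset.mem_map.1 hP
    exact P.2

/-- The nonzero primes of norm `q ≠ 0`, as prime elements of the monoid of ideals. -/
def primeOfNormEquiv [Module.Free ℤ R] {q : ℕ} (hq : q ≠ 0) :
    {P : {P : Ideal R // Prime P} // Ideal.absNorm P.1 = q} ≃ PrimesOfNorm R q where
  toFun P := ⟨P.1.1, Ideal.isPrime_of_prime P.1.2, P.2⟩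
  invFun P := ⟨⟨P.1, Ideal.prime_of_isPrime
    (fun h ↦ hq (by rw [← P.2.2, h, Ideal.absNorm_bot])) P.2.1⟩, P.2.2⟩
  left_inv _ := rfl
  right_inv _ := rfl

/-- The ideals of norm `n ≠ 0` are nonzero. -/
def idealOfNormEquiv [Module.Free ℤ R] {n : ℕ} (hn : n ≠ 0) :
    {I : Ideal R // Ideal.absNorm I = n} ≃
      {I : {I : Ideal R // I ≠ 0} // Ideal.absNorm I.1 = n} where
  toFun I := ⟨⟨I.1, fun h ↦ hn (by rw [← I.2, h, Ideal.zero_eq_bot, Ideal.absNorm_bot])⟩, I.2⟩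
  invFun I := ⟨I.1.1, I.2⟩
  left_inv _ := rfl
  right_inv _ := rfl

variable {R} {S : Type*} [CommRing S] [IsDedekindDomain S] [Module.Free ℤ R] [Module.Free ℤ S]

theorem exists_primes_equiv [Module.Finite ℤ R] [CharZero R] [Module.Finite ℤ S] [CharZero S]
    (h : ∀ q ≠ 0, Nat.card (PrimesOfNorm R q) = Nat.card (PrimesOfNorm S q)) :
    ∃ e : {P : Ideal R // Prime P} ≃ {P : Ideal S // Prime P},
      ∀ P, Ideal.absNorm (e P).1 = Ideal.absNorm P.1 := by
  have key : ∀ q, Nonempty ({P : {P : Ideal R // Prime P} // Ideal.absNorm P.1 = q} ≃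
      {P : {P : Ideal S // Prime P} // Ideal.absNorm P.1 = q}) := by
    intro q
    rcases eq_or_ne q 0 with rfl | hq
    · have h₁ : IsEmpty {P : {P : Ideal R // Prime P} // Ideal.absNorm P.1 = 0} :=
        ⟨fun P ↦ P.1.2.ne_zero (Ideal.absNorm_eq_zero_iff.1 P.2)⟩
      have h₂ : IsEmpty {P : {P : Ideal S // Prime P} // Ideal.absNorm P.1 = 0} :=
        ⟨fun P ↦ P.1.2.ne_zero (Ideal.absNorm_eq_zero_iff.1 P.2)⟩
      exact ⟨Equiv.equivOfIsEmpty _ _⟩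
    · obtain ⟨e⟩ := Finite.card_eq.1 (h q hq)
      exact ⟨((primeOfNormEquiv R hq).trans e).trans (primeOfNormEquiv S hq).symm⟩
  let e := (Equiv.sigmaFiberEquiv fun P : {P : Ideal R // Prime P} ↦ Ideal.absNorm P.1).symm.trans
    ((Equiv.sigmaCongrRight fun q ↦ (key q).some).trans
      (Equiv.sigmaFiberEquiv fun P : {P : Ideal S // Prime P} ↦ Ideal.absNorm P.1))
  exact ⟨e, fun P ↦ ((key (Ideal.absNorm P.1)).some ⟨P, rfl⟩).2⟩

/-- By unique factorization and multiplicativity of the norm, a norm-preserving bijection of the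
primes extends to the non-zero ideals. -/
theorem card_ideal_absNorm_eq [Module.Finite ℤ R] [CharZero R] [Module.Finite ℤ S] [CharZero S]
    (h : ∀ q ≠ 0, Nat.card (PrimesOfNorm R q) = Nat.card (PrimesOfNorm S q)) {n : ℕ} (hn : n ≠ 0) :
    Nat.card {I : Ideal R // Ideal.absNorm I = n} =
      Nat.card {I : Ideal S // Ideal.absNorm I = n} := by
  obtain ⟨e, he⟩ := exists_primes_equiv h
  let m : Multiset {P : Ideal R // Prime P} ≃ Multiset {P : Ideal S // Prime P} :=
    { toFun := Multiset.map e
      invFun := Multiset.map e.symm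
      left_inv s := by simp
      right_inv s := by simp }
  let E : {I : Ideal R // I ≠ 0} ≃ {I : Ideal S // I ≠ 0} :=
    (nonzeroIdealEquivMultiset R).trans (m.trans (nonzeroIdealEquivMultiset S).symm)
  have hE : ∀ I, Ideal.absNorm (E I).1 = Ideal.absNorm I.1 := by
    intro I
    obtain ⟨s, rfl⟩ := (nonzeroIdealEquivMultiset R).symm.surjective I
    change Ideal.absNorm (((nonzeroIdealEquivMultiset S).symm
      (m (nonzeroIdealEquivMultiset R ((nonzeroIdealEquivMultiset R).symm s)))).1) =
        Ideal.absNorm (s.map Subtype.val).prod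
    rw [Equiv.apply_symm_apply]
    change Ideal.absNorm ((s.map e).map Subtype.val).prod = _
    rw [map_multiset_prod, map_multiset_prod, Multiset.map_map, Multiset.map_map, Multiset.map_map]
    congr 1
    exact Multiset.map_congr rfl fun P _ ↦ he P
  exact Nat.card_congr (((idealOfNormEquiv R hn).trans (E.subtypeEquiv fun I ↦ by rw [hE])).trans
    (idealOfNormEquiv S hn).symm)

end IdealCounting

theorem isEmpty_primesOfNorm {R : Type*} [CommRing R] [IsDedekindDomain R] [Module.Free ℤ R]
    {q : ℕ} (hq : q ≠ 0) (hpow : ¬ ∃ p n : ℕ, p.Prime ∧ q = p ^ n) :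
    IsEmpty (PrimesOfNorm R q) := by
  classical
  refine ⟨fun ⟨P, hP, hN⟩ ↦ hpow ?_⟩
  rw [Ideal.absNorm_eq_natCard_quotient] at hN
  have : Finite (R ⧸ P) := Nat.finite_of_card_ne_zero (by rwa [hN])
  have : Fintype (R ⧸ P) := Fintype.ofFinite _
  let := Fintype.fieldOfDomain (R ⧸ P)
  obtain ⟨p, hp⟩ := CharP.exists (R ⧸ P)
  obtain ⟨n, hp, hn⟩ := FiniteField.card (R ⧸ P) p
  exact ⟨p, n, hp, by rw [← hN, Nat.card_eq_fintype_card, hn]⟩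

theorem card_primesOfNorm_eq {R S : Type*} [CommRing R] [IsDedekindDomain R] [Module.Free ℤ R]
    [Module.Finite ℤ R] [CharZero R] [CommRing S] [IsDedekindDomain S] [Module.Free ℤ S]
    [Module.Finite ℤ S] [CharZero S]
    (h : ∀ p n : ℕ, p.Prime → Nat.card (PrimesOfNorm R (p ^ n)) =
      Nat.card (PrimesOfNorm S (p ^ n))) {q : ℕ} (hq : q ≠ 0) :
    Nat.card (PrimesOfNorm R q) = Nat.card (PrimesOfNorm S q) := by
  by_cases hpow : ∃ p n : ℕ, p.Prime ∧ q = p ^ n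
  · obtain ⟨p, n, hp, rfl⟩ := hpow
    exact h p n hp
  · have h₁ := isEmpty_primesOfNorm hq hpow (R := R)
    have h₂ := isEmpty_primesOfNorm hq hpow (R := S)
    rw [Nat.card_of_isEmpty, Nat.card_of_isEmpty]

theorem GassmannEquivalent.arithmeticallyEquivalent {M : Type*} [Field M] [NumberField M]
    [IsGalois ℚ M] {K L : IntermediateField ℚ M}
    (h : GassmannEquivalent K.fixingSubgroup L.fixingSubgroup) :
    NumberField.ArithmeticallyEquivalent K L := by
  have hprimes : ∀ q ≠ 0, Nat.card (PrimesOfNorm (𝓞 K) q) = Nat.card (PrimesOfNorm (𝓞 L) q) := by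
    intro q hq
    refine card_primesOfNorm_eq (fun p n hp ↦ ?_) hq
    have : Fact p.Prime := ⟨hp⟩
    have hfin : ∀ E : IntermediateField ℚ M, Finite (𝓞 E →+* AlgebraicClosure (ZMod p)) := by
      intro E
      refine Finite.of_surjective (fun y : 𝓞 M →+* AlgebraicClosure (ZMod p) ↦
        y.comp (algebraMap (𝓞 E) (𝓞 M))) fun f ↦ ?_
      obtain ⟨y, hy⟩ := exists_ringHom_extension (B := 𝓞 M)
        (FaithfulSMul.algebraMap_injective (𝓞 E) (𝓞 M)) f
      exact ⟨y, RingHom.ext hy⟩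
    have := hfin K
    have := hfin L
    exact card_primesOfNorm_pow_eq p (Ω := AlgebraicClosure (ZMod p))
      (fun n ↦ h.card_ringHom_eq (iterateFrobenius _ p n)) n
  funext s
  -- An L-series ignores its coefficient at 0, so norms `n ≠ 0` suffice.
  refine LSeries_congr (fun {n} hn ↦ ?_) s
  rw [card_ideal_absNorm_eq hprimes hn]

/-! ### Transport along isomorphisms, and the main theorem -/

theorem GassmannEquivalent.map_mulEquiv {G G' : Type*} [Group G] [Group G'] {U V : Subgroup G}
    (h : GassmannEquivalent U V) (e : G ≃* G') :
    GassmannEquivalent (U.map e.toMonoidHom) (V.map e.toMonoidHom) := by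
  intro C
  obtain ⟨a, rfl⟩ := ConjClasses.exists_rep C
  have key : ∀ W : Subgroup G, ((ConjClasses.mk a).carrier ∩ (W.map e.toMonoidHom : Set G')) =
      e '' ((ConjClasses.mk (e.symm a)).carrier ∩ (W : Set G)) := by
    intro W
    ext x
    constructor
    · rintro ⟨hx, y, hy, rfl⟩
      refine ⟨y, ⟨?_, hy⟩, rfl⟩
      rw [ConjClasses.mem_carrier_iff_mk_eq, ConjClasses.mk_eq_mk_iff_isConj] at hx ⊢
      simpa using e.symm.toMonoidHom.map_isConj hx
    · rintro ⟨y, ⟨hy, hyW⟩, rfl⟩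
      refine ⟨?_, y, hyW, rfl⟩
      rw [ConjClasses.mem_carrier_iff_mk_eq, ConjClasses.mk_eq_mk_iff_isConj] at hy ⊢
      simpa using e.toMonoidHom.map_isConj hy
  rw [key, key, Set.ncard_image_of_injective _ e.injective,
    Set.ncard_image_of_injective _ e.injective]
  exact h _

theorem SubgroupsConjugate.map {G G' : Type*} [Group G] [Group G'] {U V : Subgroup G}
    (h : SubgroupsConjugate U V) (f : G →* G') : SubgroupsConjugate (U.map f) (V.map f) := by
  obtain ⟨g, rfl⟩ := h
  refine ⟨f g, ?_⟩
  rw [Subgroup.map_map, Subgroup.map_map]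
  congr 1
  exact MonoidHom.ext fun x ↦ by simp

theorem mainTheorem9 :
    (∀ (F : Type*) [Field F] [Finite F] (d : ℕ), 3 ≤ d →
      ∀ ℓ W : Submodule F (Fin d → F), Module.finrank F ℓ = 1 → Module.finrank F W + 1 = d →
        -- the two stabilizers in `PSL_d(F)`
        (IsCoatom (pslStabilizer ℓ) ∧ IsCoatom (pslStabilizer W) ∧
          SylowConjugate (pslStabilizer ℓ) (pslStabilizer W) ∧
          ¬ SubgroupsConjugate (pslStabilizer ℓ) (pslStabilizer W) ∧
          (∃ φ : MulAut (Matrix.ProjectiveSpecialLinearGroup (Fin d) F),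
            φ ∉ (MulAut.conj (G := Matrix.ProjectiveSpecialLinearGroup (Fin d) F)).range ∧
              (pslStabilizer ℓ).map φ.toMonoidHom = pslStabilizer W) ∧
          GassmannEquivalent (pslStabilizer ℓ) (pslStabilizer W)) ∧
        -- their fixed fields, for every realization of `PSL_d(F)` as a Galois group over `ℚ`
        (∀ (M : Type*) [Field M] [NumberField M] [IsGalois ℚ M]
          (e : Gal(M/ℚ) ≃* Matrix.ProjectiveSpecialLinearGroup (Fin d) F)
          (K L : IntermediateField ℚ M),
          K = IntermediateField.fixedField ((pslStabilizer ℓ).comap e.toMonoidHom) →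
          L = IntermediateField.fixedField ((pslStabilizer W).comap e.toMonoidHom) →
          NumberField.SylowConjugate K L ∧ NumberField.ArithmeticallyEquivalent K L ∧
            IsEmpty (K ≃+* L))) ∧
    -- `PSL_3(2)` is a Galois group over `ℚ`
    (∃ (M : Type) (_ : Field M) (_ : NumberField M), IsGalois ℚ M ∧
      Nonempty (Gal(M/ℚ) ≃* Matrix.ProjectiveSpecialLinearGroup (Fin 3) (ZMod 2))) := by
  refine ⟨fun F _ _ d hd ℓ W hℓ hW ↦ ?_, exists_galois_PSL_three_two⟩
  obtain ⟨v, hv, rfl⟩ := exists_span_eq hℓ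
  obtain ⟨w, hw, rfl⟩ := exists_hyp_eq hW
  have hcoatom := isCoatom_pslStabilizer_span (F := F) (le_of_lt hd) hv
  have hsylow := sylowConjugate_span_hyp hv hw
  have hconj := not_conjugate_span_hyp hd hv (w := w)
  have hgassmann := gassmannEquivalent_span_hyp hv hw
  obtain ⟨φ, hφ⟩ := exists_mulAut_map_eq hv hw
  refine ⟨⟨hcoatom, hφ ▸ hcoatom.map_mulAut φ, hsylow, hconj, ⟨φ, ?_, hφ⟩, hgassmann⟩, ?_⟩
  -- An inner `φ` would make the two stabilizers conjugate.
  · rintro ⟨x, rfl⟩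
    exact hconj ⟨x, hφ⟩
  · intro M _ _ _ e K L hK hL
    have key : ∀ A : Subgroup (Matrix.ProjectiveSpecialLinearGroup (Fin d) F),
        (IntermediateField.fixedField (A.comap e.toMonoidHom)).fixingSubgroup =
          A.map e.symm.toMonoidHom := fun A ↦ by
      rw [IntermediateField.fixingSubgroup_fixedField]
      exact (Subgroup.map_equiv_eq_comap_symm e.symm A).symm
    have hK' := key (pslStabilizer (Submodule.span F {v}))
    have hL' := key (pslStabilizer (hyp w))
    rw [← hK] at hK'
    rw [← hL] at hL'
    refine ⟨NumberField.sylowConjugate_of_fixingSubgroup ?_,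
      GassmannEquivalent.arithmeticallyEquivalent ?_,
      isEmpty_ringEquiv_of_not_subgroupsConjugate fun h ↦ hconj ?_⟩
    · rw [hK', hL']
      exact hsylow.map _
    · rw [hK', hL']
      exact hgassmann.map_mulEquiv e.symm
    · rw [hK', hL'] at h
      have := h.map e.toMonoidHom
      simpa [Subgroup.map_map] using this
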